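/- Let $W(\cdot|\cdot)$ be a discrete memoryless channel with finite input alphabet $\mathcal X$ and finite output alphabet $\mathcal Y$, let $0\in\mathcal X$ be a distinguished "off" symbol, and put $Q_0=W(\cdot|0)$. Assume that $Q_0(y)>0$ for all $y\in\mathcal Y$ and that no two input symbols induce the same output distribution. All logarithms are natural. A random code of blocklength $n$ for a finite nonempty message set $\mathcal M$ is a random pair of an encoder $\mathcal M\to\mathcal X^n$ and a decoder $\mathcal Y^n\to\mathcal M$ (drawn from an arbitrary distribution, known to both terminals). Together with an independent message, uniform on $\mathcal M$, it induces a distribution $Q^n$ on $\mathcal Y^n$. For $\delta>0$ and $\epsilon>0$ let $K_n(\delta,\epsilon)$ be the maximum of $\log|\mathcal M|$ over all random codes of blocklength $n$ with $D(Q^n\|Q_0^{\times n})\le\delta$ and average error probability (over code, message and channel) at most $\epsilon$, and let $$L=\lim_{\epsilon\downarrow0}\liminf_{n\to\infty}\frac{K_n(\delta,\epsilon)}{\sqrt{n\delta}} .$$ Suppose that some capacity-achieving input distribution assigns positive probability to every input symbol. Let $C$ be the capacity and $Q^*$ the capacity-achieving output distribution of the channel, and let $$s(y)=Q_0(y)\left(\log\frac{Q^*(y)}{Q_0(y)}+C\right),\qquad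 y\in\mathcal Y .$$ If the linear system $$\sum_{x\in\mathcal X\setminus\{0\}}\alpha_x\,\bigl(W(\cdot|x)-Q_0\bigr)=s$$ has a solution with $\alpha_x\ge0$ for all $x\ne0$, then for every $\delta>0$ the limit $L$ exists and $$L=\sqrt{2\,\mathrm{var}_{Q_0}\!\left(\log\frac{Q_0(Y)}{Q^*(Y)}\right)},$$ where $\mathrm{var}_{Q_0}$ denotes the variance when $Y$ has distribution $Q_0$. Moreover, for every integer $k\ge2$, every $p\in(0,1)$ and every $\delta>0$, the $k$-ary uniform-error channel with $\mathcal X=\mathcal Y=\{0,\dots,k-1\}$, $W(y|x)=1-p$ if $y=x$ and $W(y|x)=p/(k-1)$ if $y\ne x$, has $L=\sqrt{2v(k,p)}$, where $$v(k,p)=(1-p)\Bigl(\log\tfrac1{1-p}\Bigr)^2+p\Bigl(\log\tfrac{k-1}{p}\Bigr)^2-\Bigl((1-p)\log\tfrac1{1-p}+p\log\tfrac{k-1}{p}\Bigr)^2 .$$ -/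

import Mathlib

open Filter Topology

namespace Covert

noncomputable section

/-- `W x y` is the probability of output `y` given input `x`: every `W x` is a probability
vector on the output alphabet. -/
def IsChannel {X Y : Type*} [Fintype Y] (W : X → Y → ℝ) : Prop :=
  ∀ x, W x ∈ stdSimplex ℝ Y

/-- The relative entropy `D(P‖Q)` (natural logarithm) of two probability vectors on a finite set;
it is `+∞` unless the support of `P` is contained in the support of `Q`. -/
def relEntropy {A : Type*} [Fintype A] (P Q : A → ℝ) : EReal :=
  open Classical in
  if ∀ a, Q a = 0 → P a = 0 then ((∑ a, P a * Real.log (P a / Q a) : ℝ) : EReal) else ⊤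

/-- The variance of `f(Y)` when `Y` has distribution `Q`. -/
def variance {Y : Type*} [Fintype Y] (Q : Y → ℝ) (f : Y → ℝ) : ℝ :=
  ∑ y, Q y * (f y - ∑ y', Q y' * f y') ^ 2

/-- The output distribution induced by the input distribution `P` through `W`. -/
def output {X Y : Type*} [Fintype X] (W : X → Y → ℝ) (P : X → ℝ) (y : Y) : ℝ :=
  ∑ x, P x * W x y

/-- The mutual information `I(P, W)` between input and output. -/
def mutualInfo {X Y : Type*} [Fintype X] [Fintype Y] (W : X → Y → ℝ) (P : X → ℝ) : ℝ :=
  ∑ x, ∑ y, P x * W x y * Real.log (W x y / output W P y)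

/-- The capacity of the channel (in nats). -/
def capacity {X Y : Type*} [Fintype X] [Fintype Y] (W : X → Y → ℝ) : ℝ :=
  sSup (mutualInfo W '' stdSimplex ℝ X)

/-- `P` is a capacity-achieving input distribution. -/
def IsCapacityAchieving {X Y : Type*} [Fintype X] [Fintype Y] (W : X → Y → ℝ)
    (P : X → ℝ) : Prop :=
  P ∈ stdSimplex ℝ X ∧ ∀ P' ∈ stdSimplex ℝ X, mutualInfo W P' ≤ mutualInfo W P

/-- `Q` is a capacity-achieving output distribution. -/
def IsCapacityAchievingOutput {X Y : Type*} [Fintype X] [Fintype Y] (W : X → Y → ℝ)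
    (Q : Y → ℝ) : Prop :=
  ∃ P, IsCapacityAchieving W P ∧ Q = output W P

/-- Some capacity-achieving input distribution uses all the input symbols. -/
def AllSymbolsUsed {X Y : Type*} [Fintype X] [Fintype Y] (W : X → Y → ℝ) : Prop :=
  ∃ P, IsCapacityAchieving W P ∧ ∀ x, 0 < P x

/-- A deterministic code of blocklength `n` with `M` messages: an encoder and a decoder. -/
abbrev Code (X Y : Type*) (n M : ℕ) : Type _ :=
  (Fin M → Fin n → X) × ((Fin n → Y) → Fin M)

/-- The probability of the output sequence `y` when the sequence `x` is sent over the memoryless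
channel `W`. -/
def blockLaw {X Y : Type*} (W : X → Y → ℝ) {n : ℕ} (x : Fin n → X) (y : Fin n → Y) : ℝ :=
  ∏ i, W (x i) (y i)

/-- The distribution of the output sequence induced by a random code (the code `c` being chosen
with probability `p c`) and an independent, uniformly distributed message. -/
def codeOutput {X Y : Type*} [Fintype X] [Fintype Y] [DecidableEq Y] (W : X → Y → ℝ) {n M : ℕ}
    (p : Code X Y n M → ℝ) (y : Fin n → Y) : ℝ :=
  ∑ c, p c * ((1 / (M : ℝ)) * ∑ m, blockLaw W (c.1 m) y)

/-- The average error probability of a random code, averaged over code and uniform message. -/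
def codeError {X Y : Type*} [Fintype X] [Fintype Y] [DecidableEq Y] (W : X → Y → ℝ) {n M : ℕ}
    (p : Code X Y n M → ℝ) : ℝ :=
  ∑ c, p c * ((1 / (M : ℝ)) * ∑ m, ∑ y, if c.2 y = m then 0 else blockLaw W (c.1 m) y)

/-- There is a random code of blocklength `n` with `M` messages, average error probability at
most `ε`, and output distribution within relative entropy `δ` of the output distribution of the
all-`off` input sequence. -/
def Achievable {X Y : Type*} [Fintype X] [Fintype Y] [DecidableEq Y]
    (W : X → Y → ℝ) (off : X) (δ ε : ℝ) (n M : ℕ) : Prop :=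
  0 < M ∧ ∃ p ∈ stdSimplex ℝ (Code X Y n M),
    relEntropy (codeOutput W p) (blockLaw W (fun _ => off)) ≤ (δ : EReal) ∧ codeError W p ≤ ε

/-- `K_n(δ, ε)`: the maximum possible value of `log M`. -/
def maxLogSize {X Y : Type*} [Fintype X] [Fintype Y] [DecidableEq Y]
    (W : X → Y → ℝ) (off : X) (δ ε : ℝ) (n : ℕ) : EReal :=
  ⨆ (M : ℕ) (_ : Achievable W off δ ε n M), ((Real.log M : ℝ) : EReal)

/-- `L = lim_{ε ↓ 0} liminf_{n → ∞} K_n(δ, ε) / √(n δ)`, the limit over `ε` existing. -/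
def IsScalingConstant {X Y : Type*} [Fintype X] [Fintype Y] [DecidableEq Y]
    (W : X → Y → ℝ) (off : X) (δ : ℝ) (L : EReal) : Prop :=
  Tendsto
    (fun ε : ℝ => liminf
      (fun n : ℕ => maxLogSize W off δ ε n / ((Real.sqrt (n * δ) : ℝ) : EReal)) atTop)
    (𝓝[>] 0) (𝓝 L)

/-- The vector `s(y) = Q₀(y) (log (Q*(y) / Q₀(y)) + C)`. -/
def tangentVector {X Y : Type*} [Fintype X] [Fintype Y] (W : X → Y → ℝ) (off : X)
    (Qstar : Y → ℝ) (y : Y) : ℝ :=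
  W off y * (Real.log (Qstar y / W off y) + capacity W)

/-- The `k`-ary uniform-error channel with error probability `p`. -/
def uniformErrorChannel (k : ℕ) (p : ℝ) (x y : Fin k) : ℝ :=
  if y = x then 1 - p else p / ((k : ℝ) - 1)

/-- The constant `v(k, p)`. -/
def uniformErrorVar (k : ℕ) (p : ℝ) : ℝ :=
  (1 - p) * Real.log (1 / (1 - p)) ^ 2 + p * Real.log (((k : ℝ) - 1) / p) ^ 2
    - ((1 - p) * Real.log (1 / (1 - p)) + p * Real.log (((k : ℝ) - 1) / p)) ^ 2

end

end Covert

/-! Put h = log(Q*/Q₀) + C. A capacity-achieving input using all symbols forces D(W(·|x)‖Q*) = C for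
every x (Kuhn–Tucker, `klSum_eq_capacity`). Information then depends on the output law alone, as C −
D(output‖Q*). Solvability of the linear system makes h centred under Q₀, with second moment v equal
to the variance in the theorem.

Converse (`log_card_le_of_covert`): Fano bounds (1 − ε) log M by log 2 + nC − D(Qⁿ‖Q*ⁿ), and the
last two terms equal the Qⁿ-mean of ∑ h(yᵢ) minus D(Qⁿ‖Q₀ⁿ). By Donsker–Varadhan at slope l that
mean is at most (δ + n log E exp(l h))/l, about (δ + n l² v/2)/l, whose minimum over l is √(2vnδ).

Achievability (`eventually_achievable`): the nonnegative solution α gives inputs that leave `off`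
with probability of order t and whose output is exactly Q₀(1 + t h). The divergence from Q₀ is about
t² v/2 per letter and the information about t v. With t = τ/√n and τ just below √(2δ/v), n letters
meet the covertness budget and carry nearly √(2vδn) nats. The output law of an i.i.d. random code,
averaged over the codebook, is exactly the product law, so covertness needs no resolvability
argument (`exists_randomCode`). A Chernoff bound on the information density controls the error. -/

namespace Covert

noncomputable section

/-! ### Relative entropy on finite sets and product laws -/

/-- The relative entropy as a real number, meaningful when `Q` dominates `P`. -/
def klSum {A : Type*} [Fintype A] (P Q : A → ℝ) : ℝ :=
  ∑ a, P a * Real.log (P a / Q a)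

/-- The variational (Donsker–Varadhan) lower bound on relative entropy. -/
lemma sum_mul_le_klSum_add_log {A : Type*} [Fintype A] {P R f : A → ℝ} {Z : ℝ}
    (hP : ∀ a, 0 ≤ P a) (hP1 : ∑ a, P a = 1) (hR : ∀ a, 0 ≤ R a) (hac : ∀ a, R a = 0 → P a = 0)
    (hZ : 0 < Z) (hle : ∑ a, R a * Real.exp (f a) ≤ Z) :
    ∑ a, P a * f a ≤ klSum P R + Real.log Z := by
  have key : ∀ a, P a * f a ≤ P a * Real.log (P a / R a) + P a * Real.log Z
      + (R a * Real.exp (f a) / Z - P a) := by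
    intro a
    rcases (hP a).eq_or_lt with h0 | hpos
    · rw [← h0]
      have := hR a
      simp only [zero_mul, zero_add, sub_zero]
      positivity
    · have hRa : 0 < R a := lt_of_le_of_ne (hR a) (fun h => hpos.ne' (hac a h.symm))
      have h1 : Real.log (R a * Real.exp (f a) / (P a * Z))
          ≤ R a * Real.exp (f a) / (P a * Z) - 1 :=
        Real.log_le_sub_one_of_pos (by positivity)
      have h2 : Real.log (R a * Real.exp (f a) / (P a * Z))
          = f a - Real.log (P a / R a) - Real.log Z := by
        rw [Real.log_div (by positivity) (by positivity), Real.log_mul hRa.ne' (by positivity),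
          Real.log_mul hpos.ne' hZ.ne', Real.log_exp, Real.log_div hpos.ne' hRa.ne']
        ring
      rw [h2] at h1
      have h3 := mul_le_mul_of_nonneg_left h1 hpos.le
      have h4 : P a * (R a * Real.exp (f a) / (P a * Z) - 1) = R a * Real.exp (f a) / Z - P a := by
        field_simp
      rw [h4] at h3
      linarith
  have hs := Finset.sum_le_sum (fun a (_ : a ∈ Finset.univ) => key a)
  rw [Finset.sum_add_distrib, Finset.sum_add_distrib, Finset.sum_sub_distrib, ← Finset.sum_mul,
    ← Finset.sum_div, hP1, one_mul] at hs
  have : (∑ a, R a * Real.exp (f a)) / Z ≤ 1 := (div_le_one hZ).2 hle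
  unfold klSum
  linarith

lemma klSum_self {A : Type*} [Fintype A] (P : A → ℝ) : klSum P P = 0 := by
  refine Finset.sum_eq_zero fun a _ => ?_
  by_cases h : P a = 0
  · simp [h]
  · rw [div_self h, Real.log_one, mul_zero]

lemma klSum_nonneg {A : Type*} [Fintype A] {P R : A → ℝ}
    (hP : P ∈ stdSimplex ℝ A) (hR : R ∈ stdSimplex ℝ A) (hac : ∀ a, R a = 0 → P a = 0) :
    0 ≤ klSum P R := by
  simpa using sum_mul_le_klSum_add_log (f := 0) hP.1 hP.2 hR.1 hac one_pos (by simp [hR.2])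

lemma sum_pi_prod {ι A : Type*} [Fintype ι] [DecidableEq ι] [Fintype A] (f : ι → A → ℝ) :
    ∑ e : ι → A, ∏ i, f i (e i) = ∏ i, ∑ a, f i a :=
  (Fintype.prod_sum f).symm

lemma sum_pi_prod_mul {ι A : Type*} [Fintype ι] [DecidableEq ι] [Fintype A] {a : ι → A → ℝ}
    (ha : ∀ i, ∑ z, a i z = 1) (j : ι) (F : A → ℝ) :
    ∑ e : ι → A, (∏ i, a i (e i)) * F (e j) = ∑ z, a j z * F z := by
  have h := sum_pi_prod (fun i z => a i z * if i = j then F z else 1)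
  have h1 : ∀ e : ι → A, ∏ i, (a i (e i) * if i = j then F (e i) else 1)
      = (∏ i, a i (e i)) * F (e j) := by
    intro e
    rw [Finset.prod_mul_distrib, Finset.prod_ite_eq' Finset.univ j (fun i => F (e i))]
    simp
  have h2 : ∀ i, ∑ z, (a i z * if i = j then F z else 1)
      = if i = j then ∑ z, a i z * F z else 1 := by
    intro i
    split_ifs <;> simp [ha]
  simp only [h1, h2] at h
  rw [h, Finset.prod_ite_eq' Finset.univ j (fun i => ∑ z, a i z * F z)]
  simp

/-- Independence of two coordinates; in random coding these are the sent codeword and a competitor.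
-/
lemma sum_pi_prod_mul_mul {ι A : Type*} [Fintype ι] [DecidableEq ι] [Fintype A] {a : A → ℝ}
    (ha : ∑ z, a z = 1) {j k : ι} (hjk : j ≠ k) (F G : A → ℝ) :
    ∑ e : ι → A, (∏ i, a (e i)) * (F (e j) * G (e k)) = (∑ z, a z * F z) * ∑ z, a z * G z := by
  have h := sum_pi_prod (fun i z => a z * ((if i = j then F z else 1) * if i = k then G z else 1))
  have h1 : ∀ e : ι → A, ∏ i, (a (e i) * ((if i = j then F (e i) else 1) *
      if i = k then G (e i) else 1)) = (∏ i, a (e i)) * (F (e j) * G (e k)) := by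
    intro e
    rw [Finset.prod_mul_distrib, Finset.prod_mul_distrib,
      Finset.prod_ite_eq' Finset.univ j (fun i => F (e i)),
      Finset.prod_ite_eq' Finset.univ k (fun i => G (e i))]
    simp
  have h2 : ∀ i, ∑ z, (a z * ((if i = j then F z else 1) * if i = k then G z else 1))
      = (if i = j then ∑ z, a z * F z else 1) * if i = k then ∑ z, a z * G z else 1 := by
    intro i
    by_cases hj : i = j
    · have hk : i ≠ k := fun hk => hjk (hj.symm.trans hk)
      simp [hj, hjk]
    · by_cases hk : i = k
      · simp [hk, hjk.symm]
      · simp [hj, hk, ha]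
  simp only [h1, h2] at h
  rw [h, Finset.prod_mul_distrib, Finset.prod_ite_eq' Finset.univ j, Finset.prod_ite_eq' Finset.univ k]
  simp

lemma prod_mem_stdSimplex {ι A : Type*} [Fintype ι] [DecidableEq ι] [Fintype A] {a : ι → A → ℝ}
    (ha : ∀ i, a i ∈ stdSimplex ℝ A) : (fun e : ι → A => ∏ i, a i (e i)) ∈ stdSimplex ℝ (ι → A) :=
  ⟨fun e => Finset.prod_nonneg fun i _ => (ha i).1 _, by
    rw [sum_pi_prod]; exact Finset.prod_eq_one fun i _ => (ha i).2⟩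

/-- Relative entropy to a product distribution is additive over product distributions. -/
lemma klSum_prod {ι A : Type*} [Fintype ι] [DecidableEq ι] [Fintype A] {a : ι → A → ℝ}
    (ha : ∀ i, a i ∈ stdSimplex ℝ A) {b : A → ℝ} (hb : ∀ z, 0 < b z) :
    klSum (fun e : ι → A => ∏ i, a i (e i)) (fun e => ∏ i, b (e i)) = ∑ i, klSum (a i) b := by
  have h1 : ∀ e : ι → A, (∏ i, a i (e i)) * Real.log ((∏ i, a i (e i)) / ∏ i, b (e i))
      = ∑ j, (∏ i, a i (e i)) * Real.log (a j (e j) / b (e j)) := by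
    intro e
    by_cases h0 : ∏ i, a i (e i) = 0
    · simp [h0]
    · rw [← Finset.mul_sum, ← Finset.prod_div_distrib, Real.log_prod]
      intro i _
      exact div_ne_zero (fun h => h0 (Finset.prod_eq_zero (Finset.mem_univ i) h)) (hb _).ne'
  unfold klSum
  simp only [h1]
  rw [Finset.sum_comm]
  exact Finset.sum_congr rfl fun j _ =>
    sum_pi_prod_mul (fun i => (ha i).2) j (fun z => Real.log (a j z / b z))

/-- Changes the reference law from q to Q₀: Fano's inequality produces the left side, while
covertness constrains the divergence on the right. -/
lemma klSum_prod_eq_sub {Y : Type*} [Fintype Y] {n : ℕ} {Q0 q : Y → ℝ} (h0 : ∀ y, 0 < Q0 y)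
    (hq : ∀ y, 0 < q y) {C : ℝ} {Qn : (Fin n → Y) → ℝ} (hQn : Qn ∈ stdSimplex ℝ (Fin n → Y)) :
    n * C - klSum Qn (fun y => ∏ i, q (y i)) =
      ∑ y, Qn y * ∑ i, (Real.log (q (y i) / Q0 (y i)) + C)
        - klSum Qn (fun y => ∏ i, Q0 (y i)) := by
  have h1 : ∀ y, Qn y * Real.log (Qn y / ∏ i, q (y i)) =
      Qn y * (n * C) - Qn y * ∑ i, (Real.log (q (y i) / Q0 (y i)) + C)
        + Qn y * Real.log (Qn y / ∏ i, Q0 (y i)) := by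
    intro y
    by_cases hy : Qn y = 0
    · simp [hy]
    · have hqp : 0 < ∏ i, q (y i) := Finset.prod_pos fun i _ => hq _
      have h0p : 0 < ∏ i, Q0 (y i) := Finset.prod_pos fun i _ => h0 _
      rw [Finset.sum_add_distrib, ← Real.log_prod (fun i _ => (div_pos (hq _) (h0 _)).ne'),
        Finset.prod_div_distrib, Real.log_div hy hqp.ne', Real.log_div hy h0p.ne',
        Real.log_div hqp.ne' h0p.ne']
      simp
      ring
  unfold klSum
  rw [Finset.sum_congr rfl fun y _ => h1 y, Finset.sum_add_distrib, Finset.sum_sub_distrib,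
    ← Finset.sum_mul, hQn.2]
  ring

/-! ### Nonasymptotic converse -/

section Converse

variable {X Y : Type*} [Fintype X] [Fintype Y] [DecidableEq Y] {W : X → Y → ℝ} {n M : ℕ}
  {p : Code X Y n M → ℝ}

lemma blockLaw_mem_stdSimplex {X Y : Type*} [Fintype Y] {W : X → Y → ℝ} {n : ℕ}
    (hW : IsChannel W) (x : Fin n → X) :
    blockLaw W x ∈ stdSimplex ℝ (Fin n → Y) :=
  prod_mem_stdSimplex fun i => hW (x i)

lemma codeOutput_nonneg (hW : IsChannel W) (hp : p ∈ stdSimplex ℝ (Code X Y n M))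
    (y : Fin n → Y) : 0 ≤ codeOutput W p y :=
  Finset.sum_nonneg fun c _ => mul_nonneg (hp.1 c) <| mul_nonneg (by positivity) <|
    Finset.sum_nonneg fun _ _ => (blockLaw_mem_stdSimplex hW _).1 y

/-- The expectation of a function of the output, over code, message and channel. -/
lemma sum_codeOutput_mul (W : X → Y → ℝ) (p : Code X Y n M → ℝ) (f : (Fin n → Y) → ℝ) :
    ∑ y, codeOutput W p y * f y
      = ∑ t : Code X Y n M × Fin M × (Fin n → Y),
          p t.1 * ((1 / (M : ℝ)) * blockLaw W (t.1.1 t.2.1) t.2.2) * f t.2.2 := by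
  simp only [Fintype.sum_prod_type, codeOutput, Finset.sum_mul]
  rw [Finset.sum_comm]
  refine Finset.sum_congr rfl fun e _ => ?_
  rw [Finset.sum_comm]
  refine Finset.sum_congr rfl fun d _ => ?_
  rw [Finset.sum_comm]
  refine Finset.sum_congr rfl fun y _ => ?_
  simp only [Finset.mul_sum, Finset.sum_mul]

lemma sum_jointLaw (hW : IsChannel W) (p : Code X Y n M → ℝ)
    (f : Code X Y n M × Fin M → ℝ) :
    ∑ t : Code X Y n M × Fin M × (Fin n → Y),
          p t.1 * ((1 / (M : ℝ)) * blockLaw W (t.1.1 t.2.1) t.2.2) * f (t.1, t.2.1)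
      = ∑ c, p c * ((1 / (M : ℝ)) * ∑ m, f (c, m)) := by
  rw [Fintype.sum_prod_type]
  refine Finset.sum_congr rfl fun c _ => ?_
  rw [Fintype.sum_prod_type, Finset.mul_sum, Finset.mul_sum]
  refine Finset.sum_congr rfl fun m _ => ?_
  dsimp only
  rw [← Finset.sum_mul, ← Finset.mul_sum, ← Finset.mul_sum, (blockLaw_mem_stdSimplex hW _).2]
  ring

lemma sum_code_const (hM : 0 < M) (hp : p ∈ stdSimplex ℝ (Code X Y n M)) (r : ℝ) :
    ∑ c, p c * ((1 / (M : ℝ)) * ∑ _m : Fin M, r) = r := by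
  have : (M : ℝ) ≠ 0 := by positivity
  simp only [Finset.sum_const, Finset.card_univ, Fintype.card_fin, nsmul_eq_mul]
  rw [← Finset.sum_mul, hp.2]
  field_simp

lemma codeOutput_mem_stdSimplex (hW : IsChannel W) (hM : 0 < M)
    (hp : p ∈ stdSimplex ℝ (Code X Y n M)) : codeOutput W p ∈ stdSimplex ℝ (Fin n → Y) := by
  refine ⟨codeOutput_nonneg hW hp, ?_⟩
  have h := sum_codeOutput_mul W p (fun _ => 1)
  have h' := sum_jointLaw hW p (fun _ => 1)
  simp only [mul_one] at h h'
  rw [h, h']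
  exact sum_code_const hM hp 1

/-- Fano-type bound: if every input letter has the same divergence `C` from `q`, the size of a code
is controlled by the divergence of its output law from the product law of `q`. -/
lemma log_card_le_of_codeError_le (hW : IsChannel W) {q : Y → ℝ} (hq : ∀ y, 0 < q y) {C ε : ℝ}
    (hC : ∀ x, klSum (W x) q = C) (hM : 0 < M) (hp : p ∈ stdSimplex ℝ (Code X Y n M))
    (herr : codeError W p ≤ ε) :
    (1 - ε) * Real.log M ≤
      Real.log 2 + (n * C - klSum (codeOutput W p) (fun y => ∏ i, q (y i))) := by
  have hM0 : (0 : ℝ) < M := by positivity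
  have hM1 : (1 : ℝ) ≤ M := by exact_mod_cast hM
  have hQ := codeOutput_mem_stdSimplex hW hM hp
  set P : Code X Y n M × Fin M × (Fin n → Y) → ℝ :=
    fun t => p t.1 * ((1 / (M : ℝ)) * blockLaw W (t.1.1 t.2.1) t.2.2) with hPdef
  -- Under `R` the output is independent of code and message, so `klSum P R` is the mutual
  -- information between (code, message) and output.
  set R : Code X Y n M × Fin M × (Fin n → Y) → ℝ :=
    fun t => p t.1 * ((1 / (M : ℝ)) * codeOutput W p t.2.2) with hRdef
  set f : Code X Y n M × Fin M × (Fin n → Y) → ℝ :=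
    fun t => if t.1.2 t.2.2 = t.2.1 then Real.log M else 0 with hf
  have hP0 : ∀ t, 0 ≤ P t := fun t => mul_nonneg (hp.1 _) <| mul_nonneg (by positivity) <|
    (blockLaw_mem_stdSimplex hW _).1 _
  have hR0 : ∀ t, 0 ≤ R t := fun t => mul_nonneg (hp.1 _) <| mul_nonneg (by positivity) <| hQ.1 _
  have hdom : ∀ t, P t ≤ codeOutput W p t.2.2 := by
    intro t
    have h1 : p t.1 * ((1 / (M : ℝ)) * blockLaw W (t.1.1 t.2.1) t.2.2)
        ≤ p t.1 * ((1 / (M : ℝ)) * ∑ m, blockLaw W (t.1.1 m) t.2.2) := by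
      refine mul_le_mul_of_nonneg_left (mul_le_mul_of_nonneg_left ?_ (by positivity)) (hp.1 _)
      exact Finset.single_le_sum (f := fun m => blockLaw W (t.1.1 m) t.2.2)
        (fun m _ => (blockLaw_mem_stdSimplex hW _).1 _) (Finset.mem_univ _)
    refine h1.trans ?_
    exact Finset.single_le_sum
      (f := fun c : Code X Y n M => p c * ((1 / (M : ℝ)) * ∑ m, blockLaw W (c.1 m) t.2.2))
      (fun c _ => mul_nonneg (hp.1 c) <| mul_nonneg (by positivity) <|
        Finset.sum_nonneg fun _ _ => (blockLaw_mem_stdSimplex hW _).1 _) (Finset.mem_univ _)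
  have hac : ∀ t, R t = 0 → P t = 0 := by
    intro t ht
    by_contra hne
    have hQpos : 0 < codeOutput W p t.2.2 := (lt_of_le_of_ne (hP0 t) (Ne.symm hne)).trans_le (hdom t)
    have hpc : p t.1 ≠ 0 := fun h => hne (by simp [hPdef, h])
    exact mul_ne_zero hpc (mul_ne_zero (by positivity) hQpos.ne') ht
  have hP1 : ∑ t, P t = 1 := by
    have := sum_jointLaw hW p (fun _ => 1)
    simp only [mul_one] at this
    rw [hPdef, this]
    exact sum_code_const hM hp 1
  -- Under `R` decoding succeeds with probability 1/M, where exp f = M, contributing 1; failure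
  -- contributes at most 1.
  have hZ : ∑ t, R t * Real.exp (f t) ≤ 2 := by
    have h1 : ∀ t, R t * Real.exp (f t) ≤ R t + p t.1 * (codeOutput W p t.2.2 *
        if t.1.2 t.2.2 = t.2.1 then 1 else 0) := by
      intro t
      simp only [hf]
      split_ifs
      · have : R t * M = p t.1 * codeOutput W p t.2.2 := by
          simp only [hRdef]; field_simp
        rw [Real.exp_log hM0, this, mul_one]
        linarith [hR0 t]
      · simp
    refine (Finset.sum_le_sum fun t _ => h1 t).trans ?_
    rw [Finset.sum_add_distrib]
    have h2 : ∑ t, R t = 1 := by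
      rw [Fintype.sum_prod_type]
      refine Eq.trans (Finset.sum_congr rfl fun c _ => ?_) (sum_code_const hM hp 1)
      rw [Fintype.sum_prod_type]
      simp only [hRdef, ← Finset.mul_sum, hQ.2, mul_one]
      simp [mul_comm]
    have h3 : ∑ t : Code X Y n M × Fin M × (Fin n → Y), p t.1 * (codeOutput W p t.2.2 *
        if t.1.2 t.2.2 = t.2.1 then 1 else 0) = 1 := by
      rw [Fintype.sum_prod_type]
      refine Eq.trans (Finset.sum_congr rfl fun c _ => ?_) hp.2
      rw [Fintype.sum_prod_type_right]
      simp only [← Finset.mul_sum, Finset.sum_ite_eq, Finset.mem_univ, if_true, mul_one, hQ.2]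
    rw [h2, h3]; norm_num
  have hDV := sum_mul_le_klSum_add_log hP0 hP1 hR0 hac two_pos hZ
  have hlow : (1 - ε) * Real.log M ≤ ∑ t, P t * f t := by
    have h1 : ∀ t, P t * f t = P t * Real.log M -
        Real.log M * (p t.1 * ((1 / (M : ℝ)) *
          if t.1.2 t.2.2 = t.2.1 then 0 else blockLaw W (t.1.1 t.2.1) t.2.2)) := by
      intro t
      simp only [hf, hPdef]
      split_ifs <;> ring
    have h2 : ∑ t : Code X Y n M × Fin M × (Fin n → Y), (p t.1 * ((1 / (M : ℝ)) *
          if t.1.2 t.2.2 = t.2.1 then 0 else blockLaw W (t.1.1 t.2.1) t.2.2)) = codeError W p := by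
      rw [Fintype.sum_prod_type]
      refine Finset.sum_congr rfl fun c _ => ?_
      rw [Fintype.sum_prod_type]
      simp only [Finset.mul_sum]
    rw [Finset.sum_congr rfl fun t _ => h1 t, Finset.sum_sub_distrib, ← Finset.sum_mul, hP1,
      ← Finset.mul_sum, h2]
    nlinarith [Real.log_nonneg hM1]
  have hkl : klSum P R = n * C - klSum (codeOutput W p) (fun y => ∏ i, q (y i)) := by
    have h1 : ∀ t, P t * Real.log (P t / R t) =
        P t * Real.log (blockLaw W (t.1.1 t.2.1) t.2.2 / ∏ i, q (t.2.2 i))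
        - P t * Real.log (codeOutput W p t.2.2 / ∏ i, q (t.2.2 i)) := by
      intro t
      by_cases h0 : P t = 0
      · simp [h0]
      · have hQpos : 0 < codeOutput W p t.2.2 :=
          (lt_of_le_of_ne (hP0 t) (Ne.symm h0)).trans_le (hdom t)
        have hpc : p t.1 ≠ 0 := fun h => h0 (by simp [hPdef, h])
        have hb : blockLaw W (t.1.1 t.2.1) t.2.2 ≠ 0 := fun h => h0 (by simp [hPdef, h])
        have hqp : 0 < ∏ i, q (t.2.2 i) := Finset.prod_pos fun i _ => hq _
        have : P t / R t = blockLaw W (t.1.1 t.2.1) t.2.2 / codeOutput W p t.2.2 := by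
          simp only [hPdef, hRdef]; field_simp
        rw [this, Real.log_div hb hQpos.ne', Real.log_div hb hqp.ne',
          Real.log_div hQpos.ne' hqp.ne']
        ring
    unfold klSum
    rw [Finset.sum_congr rfl fun t _ => h1 t, Finset.sum_sub_distrib]
    congr 1
    -- As every letter is at divergence C from q, the codeword's composition does not matter.
    · have h3 : ∀ x : Fin n → X, ∑ y, blockLaw W x y * Real.log (blockLaw W x y / ∏ i, q (y i))
          = n * C := by
        intro x
        have := klSum_prod (fun i => hW (x i)) hq
        simp only [hC] at this
        simpa [klSum, blockLaw] using this
      rw [← sum_code_const hM hp (n * C), Fintype.sum_prod_type]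
      refine Finset.sum_congr rfl fun c _ => ?_
      rw [Fintype.sum_prod_type, Finset.mul_sum, Finset.mul_sum]
      refine Finset.sum_congr rfl fun m _ => ?_
      rw [← h3 (c.1 m)]
      simp only [hPdef, Finset.mul_sum, mul_assoc]
    · exact (sum_codeOutput_mul W p
        (fun y => Real.log (codeOutput W p y / ∏ i, q (y i)))).symm
  linarith

/-- Nonasymptotic converse for covert codes. -/
lemma log_card_le_of_covert (hW : IsChannel W) {off : X} (hoff : ∀ y, 0 < W off y)
    {q : Y → ℝ} (hq : ∀ y, 0 < q y) {C ε δ l w : ℝ} (hC : ∀ x, klSum (W x) q = C) (hM : 0 < M)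
    (hp : p ∈ stdSimplex ℝ (Code X Y n M)) (herr : codeError W p ≤ ε)
    (hcov : klSum (codeOutput W p) (blockLaw W fun _ => off) ≤ δ) (hl : 0 < l)
    (hexp : ∑ y, W off y * Real.exp (l * (Real.log (q y / W off y) + C)) ≤ Real.exp w) :
    (1 - ε) * Real.log M ≤ Real.log 2 + (δ + n * w) / l := by
  have hQ := codeOutput_mem_stdSimplex hW hM hp
  have h1 := log_card_le_of_codeError_le hW hq hC hM hp herr
  rw [klSum_prod_eq_sub hoff hq hQ] at h1
  have hpos : ∀ y : Fin n → Y, 0 < blockLaw W (fun _ => off) y := fun y =>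
    Finset.prod_pos fun i _ => hoff _
  have h2 : 0 ≤ klSum (codeOutput W p) (blockLaw W fun _ => off) :=
    klSum_nonneg hQ (blockLaw_mem_stdSimplex hW _) fun y h => absurd h (hpos y).ne'
  -- Donsker–Varadhan with an additive exponent, whose moment generating function factorizes over
  -- the n letters.
  have h3 := sum_mul_le_klSum_add_log (P := codeOutput W p) (R := blockLaw W fun _ => off)
    (f := fun y => l * ∑ i, (Real.log (q (y i) / W off (y i)) + C)) (Z := Real.exp (n * w))
    hQ.1 hQ.2 (fun y => (hpos y).le) (fun y h => absurd h (hpos y).ne') (Real.exp_pos _) (by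
      have : ∀ y : Fin n → Y, blockLaw W (fun _ => off) y *
          Real.exp (l * ∑ i, (Real.log (q (y i) / W off (y i)) + C))
          = ∏ i, (W off (y i) * Real.exp (l * (Real.log (q (y i) / W off (y i)) + C))) := by
        intro y
        rw [Finset.prod_mul_distrib, Finset.mul_sum, Real.exp_sum]
        rfl
      simp only [this]
      rw [sum_pi_prod (fun (_ : Fin n) z =>
        W off z * Real.exp (l * (Real.log (q z / W off z) + C)))]
      simp only [Finset.prod_const, Finset.card_univ, Fintype.card_fin]
      rw [Real.exp_nat_mul]
      exact pow_le_pow_left₀ (Finset.sum_nonneg fun y _ =>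
        mul_nonneg (hoff y).le (Real.exp_pos _).le) hexp n)
  rw [Real.log_exp] at h3
  have h4 : ∑ y, codeOutput W p y * ∑ i, (Real.log (q (y i) / W off (y i)) + C)
      ≤ (δ + n * w) / l := by
    rw [le_div_iff₀ hl, Finset.sum_mul]
    refine le_trans (le_of_eq (Finset.sum_congr rfl fun y _ => ?_)) (h3.trans (by linarith))
    ring
  have h5 : klSum (codeOutput W p) (fun y => ∏ i, W off (y i))
    = klSum (codeOutput W p) (blockLaw W fun _ => off) := rfl
  rw [h5] at h1
  linarith

end Converse

/-! ### Random coding -/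

/-- Random coding with a threshold decoder: the output law of the ensemble is exactly the output
law of the input distribution. -/
lemma exists_randomCode {A B : Type*} [Fintype A] [Fintype B] [DecidableEq B] {P : A → ℝ}
    (hP : P ∈ stdSimplex ℝ A) {V : A → B → ℝ} (hV : ∀ a, V a ∈ stdSimplex ℝ B) {M : ℕ}
    (hM : 0 < M) {θ : ℝ} (hθ : 0 < θ) :
    ∃ p ∈ stdSimplex ℝ ((Fin M → A) × (B → Fin M)),
      (∀ b, ∑ c, p c * ((1 / (M : ℝ)) * ∑ m, V (c.1 m) b) = ∑ a, P a * V a b) ∧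
      ∑ c, p c * ((1 / (M : ℝ)) * ∑ m, ∑ b, if c.2 b = m then 0 else V (c.1 m) b) ≤
        (∑ a, ∑ b, P a * if V a b ≤ θ * ∑ a', P a' * V a' b then V a b else 0) + M / θ := by
  classical
  have hM0 : (M : ℝ) ≠ 0 := by positivity
  set q : B → ℝ := fun b => ∑ a, P a * V a b with hq
  have hq0 : ∀ b, 0 ≤ q b := fun b => Finset.sum_nonneg fun a _ => mul_nonneg (hP.1 a) ((hV a).1 b)
  have hq1 : ∑ b, q b = 1 := by
    simp only [hq]
    rw [Finset.sum_comm]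
    simp only [← Finset.mul_sum, (hV _).2, mul_one, hP.2]
  -- Any codeword above the threshold may be chosen. If none is, the default 0 is harmless: the sent
  -- codeword is then below it too, and the `bad` term pays for the error.
  set dec : (Fin M → A) → B → Fin M := fun e b =>
    if h : ∃ m, θ * q b < V (e m) b then h.choose else ⟨0, hM⟩ with hdec
  have hdec' : ∀ e b m, dec e b ≠ m → V (e m) b ≤ θ * q b ∨ ∃ m', m' ≠ m ∧ θ * q b < V (e m') b := by
    intro e b m hne
    by_cases h : ∃ m, θ * q b < V (e m) b
    · right
      refine ⟨dec e b, hne, ?_⟩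
      simp only [hdec, dif_pos h]
      exact h.choose_spec
    · left
      exact not_lt.1 fun h' => h ⟨m, h'⟩
  set p : (Fin M → A) × (B → Fin M) → ℝ :=
    fun c => (∏ m, P (c.1 m)) * if c.2 = dec c.1 then 1 else 0 with hp
  have hsum : ∀ F : (Fin M → A) × (B → Fin M) → ℝ,
      ∑ c, p c * F c = ∑ e, (∏ m, P (e m)) * F (e, dec e) := by
    intro F
    rw [Fintype.sum_prod_type]
    refine Finset.sum_congr rfl fun e _ => ?_
    simp only [hp, mul_ite, mul_one, mul_zero, ite_mul, zero_mul, Finset.sum_ite_eq',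
      Finset.mem_univ, if_true]
  have hPn := prod_mem_stdSimplex (fun _ : Fin M => hP)
  refine ⟨p, ⟨fun c => mul_nonneg (hPn.1 c.1) (by split_ifs <;> simp), ?_⟩, ?_, ?_⟩
  · have := hsum (fun _ => 1)
    simp only [mul_one] at this
    rw [this]
    exact hPn.2
  · intro b
    rw [hsum]
    have : ∀ e : Fin M → A, (∏ m, P (e m)) * ((1 / (M : ℝ)) * ∑ m, V (e m) b)
        = (1 / (M : ℝ)) * ∑ m, (∏ m, P (e m)) * V (e m) b := by
      intro e
      rw [← Finset.mul_sum]; ring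
    simp only [this]
    rw [← Finset.mul_sum, Finset.sum_comm]
    simp only [sum_pi_prod_mul (fun _ : Fin M => hP.2) _ (fun a => V a b)]
    simp
    field_simp
  · rw [hsum]
    set bad : A → B → ℝ := fun a b => if V a b ≤ θ * q b then V a b else 0 with hbad
    set hit : A → B → ℝ := fun a b => if θ * q b < V a b then 1 else 0 with hhit
    -- Union bound: either the sent codeword misses the threshold or some other codeword exceeds it.
    have hpt : ∀ (e : Fin M → A) m b, (if dec e b = m then 0 else V (e m) b) ≤
        bad (e m) b + ∑ m' ∈ Finset.univ.erase m, V (e m) b * hit (e m') b := by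
      intro e m b
      have hV0 := (hV (e m)).1 b
      have hb0 : 0 ≤ bad (e m) b := by simp only [hbad]; split_ifs <;> simp [hV0]
      have hterm : ∀ m', 0 ≤ V (e m) b * hit (e m') b := fun m' =>
        mul_nonneg hV0 (by simp only [hhit]; split_ifs <;> simp)
      have hs0 : 0 ≤ ∑ m' ∈ Finset.univ.erase m, V (e m) b * hit (e m') b :=
        Finset.sum_nonneg fun m' _ => hterm m'
      split_ifs with h
      · positivity
      · rcases hdec' e b m h with h1 | ⟨m', hm', h1⟩
        · have : bad (e m) b = V (e m) b := by simp only [hbad, if_pos h1]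
          linarith
        · have : V (e m) b ≤ ∑ m' ∈ Finset.univ.erase m, V (e m) b * hit (e m') b := by
            refine le_trans (le_of_eq ?_) (Finset.single_le_sum (fun m' _ => hterm m')
              (Finset.mem_erase.2 ⟨hm', Finset.mem_univ m'⟩))
            simp [hhit, h1]
          linarith
    -- Markov's inequality: for an independent codeword and q b > 0, the ratio V a b / q b has mean
    -- 1.
    have hhitle : ∀ b, q b * ∑ a, P a * hit a b ≤ q b / θ := by
      intro b
      rcases (hq0 b).eq_or_lt with h0 | hpos
      · simp [← h0]
      · have : ∑ a, P a * hit a b ≤ ∑ a, P a * (V a b / (θ * q b)) := by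
          refine Finset.sum_le_sum fun a _ => mul_le_mul_of_nonneg_left ?_ (hP.1 a)
          simp only [hhit]
          split_ifs with h
          · exact (one_le_div (by positivity)).2 h.le
          · exact div_nonneg ((hV a).1 b) (by positivity)
        have h2 : ∑ a, P a * (V a b / (θ * q b)) = 1 / θ := by
          have : ∀ a, P a * (V a b / (θ * q b)) = P a * V a b / (θ * q b) := fun a => by ring
          simp only [this]
          rw [← Finset.sum_div]
          change q b / (θ * q b) = 1 / θ
          field_simp
        calc q b * ∑ a, P a * hit a b ≤ q b * (1 / θ) :=
              mul_le_mul_of_nonneg_left (this.trans h2.le) hpos.le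
          _ = q b / θ := by ring
    have hm : ∀ m, ∑ e : Fin M → A, (∏ m, P (e m)) * ∑ b, (if dec e b = m then 0 else V (e m) b)
        ≤ (∑ a, ∑ b, P a * bad a b) + M / θ := by
      intro m
      calc ∑ e : Fin M → A, (∏ m, P (e m)) * ∑ b, (if dec e b = m then 0 else V (e m) b)
          ≤ ∑ e : Fin M → A, (∏ m, P (e m)) * ∑ b,
              (bad (e m) b + ∑ m' ∈ Finset.univ.erase m, V (e m) b * hit (e m') b) :=
            Finset.sum_le_sum fun e _ => mul_le_mul_of_nonneg_left
              (Finset.sum_le_sum fun b _ => hpt e m b) (hPn.1 e)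
        _ = ∑ b, (∑ e : Fin M → A, (∏ m, P (e m)) * bad (e m) b +
              ∑ m' ∈ Finset.univ.erase m, ∑ e : Fin M → A,
                (∏ m, P (e m)) * (V (e m) b * hit (e m') b)) := by
            simp only [Finset.mul_sum, mul_add, Finset.sum_add_distrib]
            congr 1
            · exact Finset.sum_comm
            · rw [Finset.sum_comm]
              exact Finset.sum_congr rfl fun b _ => Finset.sum_comm
        _ = ∑ b, (∑ a, P a * bad a b +
              ∑ m' ∈ Finset.univ.erase m, q b * ∑ a, P a * hit a b) := by
            refine Finset.sum_congr rfl fun b _ => ?_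
            congr 1
            · exact sum_pi_prod_mul (fun _ : Fin M => hP.2) m (fun a => bad a b)
            · refine Finset.sum_congr rfl fun m' hm' => ?_
              exact sum_pi_prod_mul_mul hP.2 (Finset.ne_of_mem_erase hm').symm
                (fun a => V a b) (fun a => hit a b)
        _ ≤ ∑ b, (∑ a, P a * bad a b + M * (q b / θ)) := by
            refine Finset.sum_le_sum fun b _ => add_le_add le_rfl ?_
            rw [Finset.sum_const, nsmul_eq_mul]
            refine mul_le_mul ?_ (hhitle b) (mul_nonneg (hq0 b) (Finset.sum_nonneg fun a _ =>
              mul_nonneg (hP.1 a) (by simp only [hhit]; split_ifs <;> simp))) (by positivity)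
            have := Finset.card_le_univ (Finset.univ.erase m)
            rw [Fintype.card_fin] at this
            exact_mod_cast this
        _ = (∑ a, ∑ b, P a * bad a b) + M / θ := by
            rw [Finset.sum_add_distrib, Finset.sum_comm, ← Finset.mul_sum, ← Finset.sum_div, hq1]
            ring
    calc ∑ e : Fin M → A, (∏ m, P (e m)) *
          ((1 / (M : ℝ)) * ∑ m, ∑ b, if dec e b = m then 0 else V (e m) b)
        = (1 / (M : ℝ)) * ∑ m, ∑ e : Fin M → A,
            (∏ m, P (e m)) * ∑ b, (if dec e b = m then 0 else V (e m) b) := by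
          rw [Finset.sum_comm, Finset.mul_sum]
          refine Finset.sum_congr rfl fun e _ => ?_
          rw [← Finset.mul_sum]; ring
      _ ≤ (1 / (M : ℝ)) * ∑ _m : Fin M, ((∑ a, ∑ b, P a * bad a b) + M / θ) :=
          mul_le_mul_of_nonneg_left (Finset.sum_le_sum fun m _ => hm m) (by positivity)
      _ = (∑ a, ∑ b, P a * bad a b) + M / θ := by
          rw [Finset.sum_const, Finset.card_univ, Fintype.card_fin, nsmul_eq_mul]
          field_simp

/-! ### Concentration of the information density -/

section Product

variable {X Y : Type*} [Fintype X] [Fintype Y] {W : X → Y → ℝ}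

/-- Chernoff bound for the information density of a memoryless channel. -/
lemma sum_lowDensity_le (hW : IsChannel W) {P : X → ℝ} (hP : P ∈ stdSimplex ℝ X) {q : Y → ℝ}
    (hq : ∀ y, 0 < q y) (n : ℕ) (T : ℝ) {l : ℝ} (hl : 0 ≤ l) :
    ∑ x : Fin n → X, ∑ y : Fin n → Y, (∏ i, P (x i)) *
        (if blockLaw W x y ≤ Real.exp T * ∏ i, q (y i) then blockLaw W x y else 0) ≤
      Real.exp (l * T) *
        (∑ x, ∑ y, P x * W x y * Real.exp (-(l * Real.log (W x y / q y)))) ^ n := by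
  -- The Chernoff indicator bound 1{i ≤ T} ≤ exp(l(T − i)) for the information density i;
  -- zero-probability pairs are trivial.
  have hpt : ∀ (x : Fin n → X) (y : Fin n → Y),
      (if blockLaw W x y ≤ Real.exp T * ∏ i, q (y i) then blockLaw W x y else 0) ≤
      Real.exp (l * T) * ∏ i, (W (x i) (y i) *
        Real.exp (-(l * Real.log (W (x i) (y i) / q (y i))))) := by
    intro x y
    have hR : 0 ≤ Real.exp (l * T) * ∏ i, (W (x i) (y i) *
        Real.exp (-(l * Real.log (W (x i) (y i) / q (y i))))) :=
      mul_nonneg (Real.exp_pos _).le (Finset.prod_nonneg fun i _ =>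
        mul_nonneg ((hW _).1 _) (Real.exp_pos _).le)
    split_ifs with h
    · rcases ((blockLaw_mem_stdSimplex hW x).1 y).eq_or_lt with h0 | hpos
      · rw [← h0]; exact hR
      · have hqp : 0 < ∏ i, q (y i) := Finset.prod_pos fun i _ => hq _
        have hne : ∀ i, W (x i) (y i) ≠ 0 := fun i h' =>
          hpos.ne' (Finset.prod_eq_zero (Finset.mem_univ i) h')
        have hlog : ∑ i, Real.log (W (x i) (y i) / q (y i)) ≤ T := by
          rw [← Real.log_prod (fun i _ => div_ne_zero (hne i) (hq _).ne'),
            Finset.prod_div_distrib]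
          have : blockLaw W x y / (∏ i, q (y i)) ≤ Real.exp T := (div_le_iff₀ hqp).2 h
          rw [← Real.log_exp T]
          exact Real.log_le_log (div_pos hpos hqp) this
        rw [Finset.prod_mul_distrib, ← Real.exp_sum, Finset.sum_neg_distrib, ← Finset.mul_sum]
        have h1 : 1 ≤ Real.exp (l * T) *
            Real.exp (-(l * ∑ i, Real.log (W (x i) (y i) / q (y i)))) := by
          rw [← Real.exp_add]
          exact Real.one_le_exp (by nlinarith)
        change blockLaw W x y ≤ Real.exp (l * T) * (blockLaw W x y * _)
        nlinarith
    · exact hR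
  calc ∑ x : Fin n → X, ∑ y : Fin n → Y, (∏ i, P (x i)) *
        (if blockLaw W x y ≤ Real.exp T * ∏ i, q (y i) then blockLaw W x y else 0)
      ≤ ∑ x : Fin n → X, ∑ y : Fin n → Y, (∏ i, P (x i)) *
        (Real.exp (l * T) * ∏ i, (W (x i) (y i) *
        Real.exp (-(l * Real.log (W (x i) (y i) / q (y i)))))) :=
        Finset.sum_le_sum fun x _ => Finset.sum_le_sum fun y _ =>
          mul_le_mul_of_nonneg_left (hpt x y) (Finset.prod_nonneg fun i _ => hP.1 _)
    _ = Real.exp (l * T) * ∑ x : Fin n → X, ∏ i, ∑ y, (P (x i) * W (x i) y *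
        Real.exp (-(l * Real.log (W (x i) y / q y)))) := by
        rw [Finset.mul_sum]
        refine Finset.sum_congr rfl fun x _ => ?_
        rw [← sum_pi_prod (fun i y => P (x i) * W (x i) y *
          Real.exp (-(l * Real.log (W (x i) y / q y)))), Finset.mul_sum]
        refine Finset.sum_congr rfl fun y _ => ?_
        rw [mul_left_comm, ← Finset.prod_mul_distrib]
        simp only [mul_assoc]
    _ = _ := by
        rw [sum_pi_prod (fun (_ : Fin n) x => ∑ y, P x * W x y *
          Real.exp (-(l * Real.log (W x y / q y))))]
        simp

lemma exp_neg_le_one_sub_add_sq {u : ℝ} (hu : |u| ≤ 1) : Real.exp (-u) ≤ 1 - u + u ^ 2 := by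
  have h := Real.abs_exp_sub_one_sub_id_le (x := -u) (by rwa [abs_neg])
  have := (abs_le.1 h).2
  nlinarith

/-- Expand to second order, average, and use 1 + z ≤ exp z. The crude constant at the second moment
suffices, since l can later be taken small. -/
lemma sum_exp_neg_le (hW : IsChannel W) {P : X → ℝ} (hP : P ∈ stdSimplex ℝ X) {i : X → Y → ℝ}
    {l : ℝ} (hb : ∀ x y, |l * i x y| ≤ 1) :
    ∑ x, ∑ y, P x * W x y * Real.exp (-(l * i x y)) ≤
      Real.exp (-(l * ∑ x, ∑ y, P x * W x y * i x y)
        + l ^ 2 * ∑ x, ∑ y, P x * W x y * i x y ^ 2) := by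
  have h1 : ∑ x, ∑ y, P x * W x y * Real.exp (-(l * i x y)) ≤
      ∑ x, ∑ y, (P x * W x y - l * (P x * W x y * i x y) + l ^ 2 * (P x * W x y * i x y ^ 2)) := by
    refine Finset.sum_le_sum fun x _ => Finset.sum_le_sum fun y _ => ?_
    have := mul_le_mul_of_nonneg_left (exp_neg_le_one_sub_add_sq (hb x y))
      (mul_nonneg (hP.1 x) ((hW x).1 y))
    refine this.trans (le_of_eq ?_)
    ring
  have h2 : ∑ x, ∑ y, P x * W x y = 1 := by
    simp only [← Finset.mul_sum, (hW _).2, mul_one, hP.2]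
  simp only [Finset.sum_add_distrib, Finset.sum_sub_distrib, ← Finset.mul_sum] at h1
  simp only [Finset.mul_sum] at h1 h2 ⊢
  rw [h2] at h1
  refine h1.trans ?_
  have := Real.add_one_le_exp (-(∑ x, ∑ y, l * (P x * W x y * i x y))
    + ∑ x, ∑ y, l ^ 2 * (P x * W x y * i x y ^ 2))
  linarith

end Product

/-! ### Second-order expansions -/

/-- Serves both directions: φ(z) = exp z − 1 gives the moment generating function of the converse,
φ(z) = (1 + z) log(1 + z) the divergence of sparse outputs. Centring kills the linear term, and the
strict inequality in `hv` absorbs the error η. -/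
lemma eventually_sum_le_sq {Y : Type*} [Fintype Y] {Q h : Y → ℝ} (hQ : ∀ y, 0 ≤ Q y)
    (hh : ∑ y, Q y * h y = 0) {φ : ℝ → ℝ}
    (hφ : ∀ η > 0, ∀ᶠ z in 𝓝 (0 : ℝ), φ z ≤ z + (1 + η) / 2 * z ^ 2) {v : ℝ}
    (hv : ∑ y, Q y * h y ^ 2 < v) :
    ∀ᶠ t in 𝓝 (0 : ℝ), ∑ y, Q y * φ (t * h y) ≤ t ^ 2 * v / 2 := by
  set u := ∑ y, Q y * h y ^ 2 with hu
  have hu0 : 0 ≤ u := Finset.sum_nonneg fun y _ => mul_nonneg (hQ y) (sq_nonneg _)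
  have hη : 0 < (v - u) / (u + 1) := div_pos (by linarith) (by linarith)
  have hηv : (1 + (v - u) / (u + 1)) * u ≤ v := by
    have : (v - u) / (u + 1) * u ≤ v - u := by
      rw [div_mul_eq_mul_div, div_le_iff₀ (by linarith)]
      nlinarith
    linarith
  have hev : ∀ y, ∀ᶠ t in 𝓝 (0 : ℝ), φ (t * h y) ≤
      t * h y + (1 + (v - u) / (u + 1)) / 2 * (t * h y) ^ 2 := by
    intro y
    have ht : Tendsto (fun t : ℝ => t * h y) (𝓝 0) (𝓝 0) := by
      have : Continuous fun t : ℝ => t * h y := by fun_prop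
      simpa using this.tendsto 0
    exact ht.eventually (hφ _ hη)
  filter_upwards [eventually_all.2 hev] with t ht
  calc ∑ y, Q y * φ (t * h y)
      ≤ ∑ y, Q y * (t * h y + (1 + (v - u) / (u + 1)) / 2 * (t * h y) ^ 2) :=
        Finset.sum_le_sum fun y _ => mul_le_mul_of_nonneg_left (ht y) (hQ y)
    _ = t * ∑ y, Q y * h y + t ^ 2 / 2 * ((1 + (v - u) / (u + 1)) * u) := by
        rw [hu, Finset.mul_sum, Finset.mul_sum, Finset.mul_sum, ← Finset.sum_add_distrib]
        exact Finset.sum_congr rfl fun y _ => by ring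
    _ ≤ t ^ 2 * v / 2 := by
        rw [hh]
        nlinarith [mul_le_mul_of_nonneg_left hηv (sq_nonneg t)]

lemma eventually_exp_sub_one_le {η : ℝ} (hη : 0 < η) :
    ∀ᶠ z in 𝓝 (0 : ℝ), Real.exp z - 1 ≤ z + (1 + η) / 2 * z ^ 2 := by
  filter_upwards [Metric.ball_mem_nhds (0 : ℝ) (lt_min one_pos hη)] with z hz
  rw [Metric.mem_ball, dist_zero_right, Real.norm_eq_abs, lt_min_iff] at hz
  have h := Real.exp_bound hz.1.le (n := 3) (by norm_num)
  norm_num [Finset.sum_range_succ, Nat.factorial] at h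
  have h1 := (abs_le.1 h).2
  have h2 : |z| ^ 3 ≤ η * z ^ 2 := by
    rw [pow_succ, sq_abs, mul_comm]
    exact mul_le_mul_of_nonneg_right hz.2.le (sq_nonneg z)
  nlinarith [abs_nonneg z, pow_nonneg (abs_nonneg z) 3]

lemma abs_log_one_add_sub_le {z : ℝ} (hz : |z| ≤ 1 / 2) :
    |Real.log (1 + z) - z + z ^ 2 / 2| ≤ 2 * |z| ^ 3 := by
  have h := Real.abs_log_sub_add_sum_range_le (x := -z) (by rw [abs_neg]; linarith) 2
  norm_num [Finset.sum_range_succ] at h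
  have h3 : |z| ^ 3 / (1 - |z|) ≤ 2 * |z| ^ 3 := by
    rw [div_le_iff₀ (by linarith)]
    nlinarith [pow_nonneg (abs_nonneg z) 3]
  refine le_trans (le_of_eq ?_) (h.trans h3)
  congr 1
  ring

lemma abs_log_one_add_le {z : ℝ} (hz : |z| ≤ 1 / 2) : |Real.log (1 + z)| ≤ 2 * |z| := by
  have h := Real.abs_log_sub_add_sum_range_le (x := -z) (by rw [abs_neg]; linarith) 0
  norm_num at h
  refine h.trans ?_
  rw [div_le_iff₀ (by linarith)]
  nlinarith [abs_nonneg z]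

lemma eventually_mul_log_le {η : ℝ} (hη : 0 < η) :
    ∀ᶠ z in 𝓝 (0 : ℝ), (1 + z) * Real.log (1 + z) ≤ z + (1 + η) / 2 * z ^ 2 := by
  have hpos : 0 < min (1 / 2 : ℝ) (η / 8) := lt_min (by norm_num) (by linarith)
  filter_upwards [Metric.ball_mem_nhds (0 : ℝ) hpos] with z hz
  rw [Metric.mem_ball, dist_zero_right, Real.norm_eq_abs, lt_min_iff] at hz
  have h1 := (abs_le.1 (abs_log_one_add_sub_le hz.1.le)).2
  have hz' := abs_le.1 hz.1.le
  have h2 : |z| ^ 3 ≤ η / 8 * z ^ 2 := by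
    rw [pow_succ, sq_abs, mul_comm]
    exact mul_le_mul_of_nonneg_right hz.2.le (sq_nonneg z)
  have h3 : (1 + z) * Real.log (1 + z) ≤ (1 + z) * (z - z ^ 2 / 2 + 2 * |z| ^ 3) :=
    mul_le_mul_of_nonneg_left (by linarith) (by linarith)
  have h4 : (1 + z) * (2 * |z| ^ 3) ≤ 3 / 2 * (2 * |z| ^ 3) :=
    mul_le_mul_of_nonneg_right (by linarith) (by positivity)
  have h5 : -z ^ 3 ≤ |z| ^ 3 := by
    rw [← abs_pow]; exact neg_le_abs _
  nlinarith

/-! ### Information as a difference of divergences -/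

section Information

variable {X Y : Type*} [Fintype X] [Fintype Y] {W : X → Y → ℝ}

lemma output_mem_stdSimplex (hW : IsChannel W) {P : X → ℝ} (hP : P ∈ stdSimplex ℝ X) :
    output W P ∈ stdSimplex ℝ Y := by
  refine ⟨fun y => Finset.sum_nonneg fun x _ => mul_nonneg (hP.1 x) ((hW x).1 y), ?_⟩
  unfold output
  rw [Finset.sum_comm]
  simp only [← Finset.mul_sum, (hW _).2, mul_one, hP.2]

/-- The compensation identity for mutual information. -/
lemma mutualInfo_eq_sub (hW : IsChannel W) {P : X → ℝ} (hP : P ∈ stdSimplex ℝ X) {q : Y → ℝ}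
    (hq : ∀ y, 0 < q y) :
    mutualInfo W P = ∑ x, P x * klSum (W x) q - klSum (output W P) q := by
  have h1 : ∀ x y, P x * W x y * Real.log (W x y / output W P y) =
      P x * (W x y * Real.log (W x y / q y))
        - P x * W x y * Real.log (output W P y / q y) := by
    intro x y
    by_cases h0 : P x * W x y = 0
    · rw [← mul_assoc, h0]; ring
    · have hnn : ∀ x, 0 ≤ P x * W x y := fun x => mul_nonneg (hP.1 x) ((hW x).1 y)
      have hO : 0 < output W P y := (lt_of_le_of_ne (hnn x) (Ne.symm h0)).trans_le <|
        Finset.single_le_sum (f := fun x => P x * W x y) (fun x _ => hnn x) (Finset.mem_univ x)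
      have hWx : W x y ≠ 0 := right_ne_zero_of_mul h0
      rw [Real.log_div hWx hO.ne', Real.log_div hWx (hq y).ne', Real.log_div hO.ne' (hq y).ne']
      ring
  unfold mutualInfo klSum
  simp only [h1, Finset.sum_sub_distrib, ← Finset.mul_sum]
  congr 1
  rw [Finset.sum_comm]
  simp only [← Finset.sum_mul]
  rfl

lemma klSum_sub_klSum {Q0 q Q : Y → ℝ} (h0 : ∀ y, 0 < Q0 y) (hq : ∀ y, 0 < q y) :
    klSum Q q = klSum Q Q0 - ∑ y, Q y * Real.log (q y / Q0 y) := by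
  unfold klSum
  rw [← Finset.sum_sub_distrib]
  refine Finset.sum_congr rfl fun y _ => ?_
  by_cases hy : Q y = 0
  · simp [hy]
  · rw [Real.log_div hy (hq y).ne', Real.log_div hy (h0 y).ne',
      Real.log_div (hq y).ne' (h0 y).ne']
    ring

end Information

/-! ### Sparse inputs -/

section Perturbation

variable {X Y : Type*} [Fintype X] [DecidableEq X] [Fintype Y] {W : X → Y → ℝ} {off : X}
  {q : Y → ℝ} {C : ℝ} {α : X → ℝ}

/-- The input distribution using the symbol `x ≠ off` with probability `t * α x`. -/
def sparseInput (off : X) (α : X → ℝ) (t : ℝ) (x : X) : ℝ :=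
  if x = off then 1 - t * ∑ x ∈ Finset.univ.erase off, α x else t * α x

lemma sum_sparseInput_mul (off : X) (α : X → ℝ) (t : ℝ) (f : X → ℝ) :
    ∑ x, sparseInput off α t x * f x
      = f off + t * ∑ x ∈ Finset.univ.erase off, α x * (f x - f off) := by
  rw [← Finset.add_sum_erase _ _ (Finset.mem_univ off)]
  have : ∑ x ∈ Finset.univ.erase off, sparseInput off α t x * f x
      = ∑ x ∈ Finset.univ.erase off, t * α x * f x := by
    refine Finset.sum_congr rfl fun x hx => ?_
    rw [sparseInput, if_neg (Finset.ne_of_mem_erase hx)]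
  rw [this, sparseInput, if_pos rfl]
  simp only [mul_sub, Finset.sum_sub_distrib, ← Finset.sum_mul, mul_assoc]
  rw [← Finset.mul_sum]
  ring

lemma output_sparseInput {X Y : Type*} [Fintype X] [DecidableEq X] {W : X → Y → ℝ} {off : X}
    {q : Y → ℝ} {C : ℝ} {α : X → ℝ}
    (hs : ∀ y, ∑ x ∈ Finset.univ.erase off, α x * (W x y - W off y) =
      W off y * (Real.log (q y / W off y) + C)) (t : ℝ) (y : Y) :
    output W (sparseInput off α t) y = W off y * (1 + t * (Real.log (q y / W off y) + C)) := by
  rw [output, sum_sparseInput_mul off α t (fun x => W x y), hs]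
  ring

lemma eventually_sparseInput_mem (hα : ∀ x, x ≠ off → 0 ≤ α x) :
    ∀ᶠ t in 𝓝[>] (0 : ℝ), sparseInput off α t ∈ stdSimplex ℝ X := by
  set A := ∑ x ∈ Finset.univ.erase off, α x with hA
  have hlim : Tendsto (fun t : ℝ => t * A) (𝓝[>] 0) (𝓝 0) := by
    have : Continuous fun t : ℝ => t * A := by fun_prop
    simpa using (this.tendsto 0).mono_left nhdsWithin_le_nhds
  filter_upwards [hlim.eventually (gt_mem_nhds one_pos), self_mem_nhdsWithin] with t h1 ht
  refine ⟨fun x => ?_, ?_⟩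
  · unfold sparseInput
    split_ifs with hx
    · linarith
    · exact mul_nonneg (le_of_lt ht) (hα x hx)
  · simpa using sum_sparseInput_mul off α t (fun _ => 1)

/-- A combination of differences of probability vectors has total mass zero. -/
lemma sum_tangent_eq_zero (hW : IsChannel W)
    (hs : ∀ y, ∑ x ∈ Finset.univ.erase off, α x * (W x y - W off y) =
      W off y * (Real.log (q y / W off y) + C)) :
    ∑ y, W off y * (Real.log (q y / W off y) + C) = 0 := by
  simp only [← hs]
  rw [Finset.sum_comm]
  simp only [← Finset.mul_sum, Finset.sum_sub_distrib, (hW _).2, sub_self, mul_zero,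
    Finset.sum_const_zero]

/-- Information is C − D(output‖q). Passing to reference Q₀ leaves the output mean of h, which is
exactly t v because the output is Q₀(1 + t h). -/
lemma mutualInfo_sparseInput (hW : IsChannel W) (hoff : ∀ y, 0 < W off y) (hq : ∀ y, 0 < q y)
    (hC : ∀ x, klSum (W x) q = C)
    (hs : ∀ y, ∑ x ∈ Finset.univ.erase off, α x * (W x y - W off y) =
      W off y * (Real.log (q y / W off y) + C)) {t : ℝ}
    (hP : sparseInput off α t ∈ stdSimplex ℝ X) :
    mutualInfo W (sparseInput off α t) =
      t * ∑ y, W off y * (Real.log (q y / W off y) + C) ^ 2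
        - klSum (output W (sparseInput off α t)) (W off) := by
  have h0 := sum_tangent_eq_zero hW hs
  have hO := (output_mem_stdSimplex hW hP).2
  rw [mutualInfo_eq_sub hW hP hq, klSum_sub_klSum hoff hq]
  simp only [hC, ← Finset.sum_mul, hP.2, one_mul]
  have h1 : ∑ y, output W (sparseInput off α t) y * Real.log (q y / W off y) =
      ∑ y, output W (sparseInput off α t) y * (Real.log (q y / W off y) + C) - C := by
    simp only [mul_add, Finset.sum_add_distrib, ← Finset.sum_mul, hO]
    ring
  have h2 : ∑ y, output W (sparseInput off α t) y * (Real.log (q y / W off y) + C) =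
      ∑ y, W off y * (Real.log (q y / W off y) + C)
        + t * ∑ y, W off y * (Real.log (q y / W off y) + C) ^ 2 := by
    rw [Finset.mul_sum, ← Finset.sum_add_distrib]
    refine Finset.sum_congr rfl fun y _ => ?_
    rw [output_sparseInput hs]
    ring
  rw [h1, h2, h0]
  ring

lemma eventually_klSum_output_le (hW : IsChannel W) (hoff : ∀ y, 0 < W off y)
    (hs : ∀ y, ∑ x ∈ Finset.univ.erase off, α x * (W x y - W off y) =
      W off y * (Real.log (q y / W off y) + C)) {v : ℝ}
    (hv : ∑ y, W off y * (Real.log (q y / W off y) + C) ^ 2 < v) :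
    ∀ᶠ t in 𝓝 (0 : ℝ), klSum (output W (sparseInput off α t)) (W off) ≤ t ^ 2 * v / 2 := by
  filter_upwards [eventually_sum_le_sq (fun y => (hoff y).le) (sum_tangent_eq_zero hW hs)
    (fun η hη => eventually_mul_log_le hη) hv] with t ht
  refine le_trans (le_of_eq (Finset.sum_congr rfl fun y _ => ?_)) ht
  rw [output_sparseInput hs, mul_div_cancel_left₀ _ (hoff y).ne']
  ring

/-- For sparse inputs the information density is bounded, and its second moment is of the order
of the sparsity. -/
lemma exists_infoDensity_bound (hW : IsChannel W) (hoff : ∀ y, 0 < W off y)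
    (hα : ∀ x, x ≠ off → 0 ≤ α x)
    (hs : ∀ y, ∑ x ∈ Finset.univ.erase off, α x * (W x y - W off y) =
      W off y * (Real.log (q y / W off y) + C)) :
    ∃ K B : ℝ, 0 < K ∧ 0 ≤ B ∧ ∀ᶠ t in 𝓝[>] (0 : ℝ),
      (∀ y, 0 < output W (sparseInput off α t) y) ∧
      (∀ x y, |Real.log (W x y / output W (sparseInput off α t) y)| ≤ K) ∧
      ∑ x, ∑ y, sparseInput off α t x * W x y *
        Real.log (W x y / output W (sparseInput off α t) y) ^ 2 ≤ B * t := by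
  set h : Y → ℝ := fun y => Real.log (q y / W off y) + C with hh
  -- The extra 1 covers |log(1 + t h)| ≤ 2|t h| < 1; where W x y = 0 the convention log 0 = 0
  -- applies.
  set K : ℝ := (∑ x, ∑ y, |Real.log (W x y / W off y)|) + 1 with hK
  set A := ∑ x ∈ Finset.univ.erase off, α x with hA
  set v := ∑ y, W off y * h y ^ 2 with hv
  have hK0 : 0 < K := add_pos_of_nonneg_of_pos
    (Finset.sum_nonneg fun _ _ => Finset.sum_nonneg fun _ _ => abs_nonneg _) one_pos
  have hA0 : 0 ≤ A := Finset.sum_nonneg fun x hx => hα x (Finset.ne_of_mem_erase hx)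
  have hv0 : 0 ≤ v := Finset.sum_nonneg fun y _ => mul_nonneg (hoff y).le (sq_nonneg _)
  -- The `off` symbol contributes at most 4 v t² ≤ 4 v t, the others at most K² times their total
  -- mass t A.
  refine ⟨K, 4 * v + A * K ^ 2, hK0, by positivity, ?_⟩
  have hsmall : ∀ y, ∀ᶠ t in 𝓝[>] (0 : ℝ), |t * h y| < 1 / 2 := by
    intro y
    have : Continuous fun t : ℝ => |t * h y| := by fun_prop
    have h2 := (this.tendsto 0).mono_left (nhdsWithin_le_nhds (s := Set.Ioi 0))
    simp only [zero_mul, abs_zero] at h2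
    exact h2.eventually (gt_mem_nhds (by norm_num))
  filter_upwards [eventually_all.2 hsmall, eventually_sparseInput_mem hα, self_mem_nhdsWithin,
    nhdsWithin_le_nhds (gt_mem_nhds one_pos)] with t ht hP ht0 ht1
  have ht0' : (0 : ℝ) < t := ht0
  have hpos : ∀ y, 0 < 1 + t * h y := fun y => by
    have := (abs_lt.1 (ht y)).1
    linarith
  have hden : ∀ x y, W x y ≠ 0 → Real.log (W x y / output W (sparseInput off α t) y) =
      Real.log (W x y / W off y) - Real.log (1 + t * h y) := by
    intro x y hne
    rw [output_sparseInput hs, ← div_div, Real.log_div (div_ne_zero hne (hoff y).ne') (hpos y).ne']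
  have hbound : ∀ x y, |Real.log (W x y / output W (sparseInput off α t) y)| ≤ K := by
    intro x y
    by_cases hne : W x y = 0
    · simp only [hne, zero_div, Real.log_zero, abs_zero]; exact hK0.le
    · rw [hden x y hne]
      have h1 : |Real.log (W x y / W off y)| ≤ ∑ x, ∑ y, |Real.log (W x y / W off y)| :=
        (Finset.single_le_sum (f := fun y => |Real.log (W x y / W off y)|)
          (fun _ _ => abs_nonneg _) (Finset.mem_univ y)).trans
        (Finset.single_le_sum (f := fun x => ∑ y, |Real.log (W x y / W off y)|)
          (fun _ _ => Finset.sum_nonneg fun _ _ => abs_nonneg _) (Finset.mem_univ x))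
      have h2 := abs_log_one_add_le (ht y).le
      have h3 := abs_sub (Real.log (W x y / W off y)) (Real.log (1 + t * h y))
      have := ht y
      linarith
  refine ⟨fun y => ?_, hbound, ?_⟩
  · rw [output_sparseInput hs]
    exact mul_pos (hoff y) (hpos y)
  · rw [← Finset.add_sum_erase _ _ (Finset.mem_univ off)]
    have hP1 : sparseInput off α t off ≤ 1 := by
      rw [sparseInput, if_pos rfl]
      nlinarith
    have hfirst : ∑ y, sparseInput off α t off * W off y *
        Real.log (W off y / output W (sparseInput off α t) y) ^ 2 ≤ 4 * v * t := by
      calc _ ≤ ∑ y, W off y * (4 * t ^ 2 * h y ^ 2) := by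
            refine Finset.sum_le_sum fun y _ => ?_
            refine mul_le_mul (mul_le_of_le_one_left (hoff y).le hP1) ?_ (sq_nonneg _) (hoff y).le
            rw [hden off y (hoff y).ne', div_self (hoff y).ne', Real.log_one, zero_sub, neg_sq,
              ← sq_abs]
            calc |Real.log (1 + t * h y)| ^ 2 ≤ (2 * |t * h y|) ^ 2 :=
                  pow_le_pow_left₀ (abs_nonneg _) (abs_log_one_add_le (ht y).le) 2
              _ = 4 * t ^ 2 * h y ^ 2 := by rw [mul_pow, sq_abs]; ring
        _ = 4 * v * t ^ 2 := by
            rw [hv, Finset.mul_sum, Finset.sum_mul]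
            exact Finset.sum_congr rfl fun y _ => by ring
        _ ≤ 4 * v * t := mul_le_mul_of_nonneg_left (by nlinarith) (by positivity)
    have hrest : ∑ x ∈ Finset.univ.erase off, ∑ y, sparseInput off α t x * W x y *
        Real.log (W x y / output W (sparseInput off α t) y) ^ 2 ≤ A * K ^ 2 * t := by
      calc _ ≤ ∑ x ∈ Finset.univ.erase off, t * α x * K ^ 2 := by
            refine Finset.sum_le_sum fun x hx => ?_
            have hx' := Finset.ne_of_mem_erase hx
            calc _ ≤ ∑ y, t * α x * W x y * K ^ 2 := by
                  refine Finset.sum_le_sum fun y _ => ?_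
                  rw [sparseInput, if_neg hx', ← sq_abs (Real.log _)]
                  exact mul_le_mul_of_nonneg_left
                    (pow_le_pow_left₀ (abs_nonneg _) (hbound x y) 2)
                    (mul_nonneg (mul_nonneg ht0'.le (hα x hx')) ((hW x).1 y))
              _ = t * α x * K ^ 2 := by
                  rw [← Finset.sum_mul, ← Finset.mul_sum, (hW x).2, mul_one]
        _ = A * K ^ 2 * t := by
            rw [← Finset.sum_mul, ← Finset.mul_sum]; ring
    linarith

end Perturbation

lemma relEntropy_eq_klSum {A : Type*} [Fintype A] {P Q : A → ℝ} (hQ : ∀ a, 0 < Q a) :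
    relEntropy P Q = ((klSum P Q : ℝ) : EReal) := by
  unfold relEntropy
  rw [if_pos fun a h => absurd h (hQ a).ne']
  rfl

lemma blockLaw_pos {X Y : Type*} {W : X → Y → ℝ} {n : ℕ} {x : Fin n → X}
    (h : ∀ i y, 0 < W (x i) y) (y : Fin n → Y) : 0 < blockLaw W x y :=
  Finset.prod_pos fun i _ => h i _

/-! ### Achievability -/

section Achievability

variable {X Y : Type*} [Fintype X] [Fintype Y] [DecidableEq Y] {W : X → Y → ℝ}
  {off : X} {q : Y → ℝ} {C : ℝ} {α : X → ℝ}

/-- Nonasymptotic achievability by i.i.d. random coding. -/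
lemma achievable_of_iid (hW : IsChannel W) (hoff : ∀ y, 0 < W off y) {P : X → ℝ}
    (hP : P ∈ stdSimplex ℝ X) (hO : ∀ y, 0 < output W P y) {n M : ℕ} (hM : 0 < M)
    {δ ε l T : ℝ} (hδ : n * klSum (output W P) (W off) ≤ δ) (hl : 0 ≤ l)
    (hb : ∀ x y, |l * Real.log (W x y / output W P y)| ≤ 1)
    (hε : Real.exp (l * T + n * (-(l * mutualInfo W P) + l ^ 2 * ∑ x, ∑ y, P x * W x y *
      Real.log (W x y / output W P y) ^ 2)) + M / Real.exp T ≤ ε) :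
    Achievable W off δ ε n M := by
  have hPn := prod_mem_stdSimplex (fun _ : Fin n => hP)
  obtain ⟨p, hp, hout, herr⟩ := exists_randomCode hPn (V := fun x : Fin n → X => blockLaw W x)
    (fun x => blockLaw_mem_stdSimplex hW x) hM (Real.exp_pos T)
  have hiid : ∀ y : Fin n → Y, ∑ x : Fin n → X, (∏ i, P (x i)) * blockLaw W x y
      = ∏ i, output W P (y i) := by
    intro y
    have := sum_pi_prod (fun (i : Fin n) x => P x * W x (y i))
    simp only [Finset.prod_mul_distrib] at this
    exact this
  have hco : codeOutput W p = fun y => ∏ i, output W P (y i) := by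
    funext y
    rw [← hiid]
    exact hout y
  refine ⟨hM, p, hp, ?_, ?_⟩
  · rw [relEntropy_eq_klSum (blockLaw_pos fun _ => hoff), hco]
    have := klSum_prod (fun _ : Fin n => output_mem_stdSimplex hW hP) hoff
    simp only [Finset.sum_const, Finset.card_univ, Fintype.card_fin, nsmul_eq_mul] at this
    have h2 : klSum (fun y : Fin n → Y => ∏ i, output W P (y i)) (blockLaw W fun _ => off) ≤ δ := by
      refine le_trans (le_of_eq ?_) hδ
      exact this
    exact_mod_cast h2
  · refine le_trans ?_ hε
    refine le_trans herr (add_le_add ?_ le_rfl)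
    simp only [hiid]
    refine (sum_lowDensity_le hW hP hO n T hl).trans ?_
    rw [Real.exp_add, Real.exp_nat_mul]
    refine mul_le_mul_of_nonneg_left (pow_le_pow_left₀ ?_ (sum_exp_neg_le hW hP hb) n)
      (Real.exp_pos _).le
    exact Finset.sum_nonneg fun x _ => Finset.sum_nonneg fun y _ =>
      mul_nonneg (mul_nonneg (hP.1 x) ((hW x).1 y)) (Real.exp_pos _).le

lemma tendsto_sqrt_natCast_atTop : Tendsto (fun n : ℕ => √(n : ℝ)) atTop atTop :=
  Real.tendsto_sqrt_atTop.comp tendsto_natCast_atTop_atTop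

lemma tendsto_div_sqrt_natCast {τ : ℝ} (hτ : 0 < τ) :
    Tendsto (fun n : ℕ => τ / √(n : ℝ)) atTop (𝓝[>] 0) := by
  refine tendsto_nhdsWithin_iff.2 ⟨tendsto_sqrt_natCast_atTop.const_div_atTop τ, ?_⟩
  filter_upwards [eventually_gt_atTop 0] with n hn
  exact div_pos hτ (Real.sqrt_pos.2 (by exact_mod_cast hn))

lemma eventually_achievable [DecidableEq X] (hW : IsChannel W) (hoff : ∀ y, 0 < W off y)
    (hq : ∀ y, 0 < q y)
    (hC : ∀ x, klSum (W x) q = C) (hα : ∀ x, x ≠ off → 0 ≤ α x)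
    (hs : ∀ y, ∑ x ∈ Finset.univ.erase off, α x * (W x y - W off y) =
      W off y * (Real.log (q y / W off y) + C)) {v τ δ r ε : ℝ}
    (hv : v = ∑ y, W off y * (Real.log (q y / W off y) + C) ^ 2)
    (hτ : 0 < τ) (hτδ : τ ^ 2 * v < 2 * δ) (hr : 0 ≤ r) (hrτ : r < τ * v) (hε : 0 < ε) :
    ∀ᶠ n : ℕ in atTop, Achievable W off δ ε n ⌈Real.exp (r * √(n : ℝ))⌉₊ := by
  obtain ⟨K, B, hK, hB, hKB⟩ := exists_infoDensity_bound (q := q) (C := C) hW hoff hα hs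
  -- The threshold exponent ρ√n lies midway between the code size r√n and the information τv√n.
  set ρ := (r + τ * v) / 2 with hρ
  have hκ : 0 < τ * v - ρ := by rw [hρ]; linarith
  -- A Chernoff slope independent of n: the second condition validates the quadratic bound, the
  -- third lets the second-moment term use at most half the gap.
  obtain ⟨l, hl, hlK, hlB⟩ : ∃ l : ℝ, 0 < l ∧ l * K ≤ 1 ∧ l * (B * τ) ≤ (τ * v - ρ) / 2 := by
    refine ⟨min (1 / K) ((τ * v - ρ) / 2 / (B * τ + 1)), lt_min (by positivity) (by positivity),
      ?_, ?_⟩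
    · exact (mul_le_mul_of_nonneg_right (min_le_left _ _) hK.le).trans (by field_simp; rfl)
    · refine (mul_le_mul_of_nonneg_right (min_le_right _ _) (by positivity)).trans ?_
      rw [div_mul_eq_mul_div, div_le_iff₀ (by positivity)]
      nlinarith
  -- With this variance bound and t = τ/√n, the total n t² (2δ/τ²)/2 is exactly δ.
  have hvδ : v < 2 * δ / τ ^ 2 := by rw [lt_div_iff₀ (by positivity)]; linarith
  have hev : ∀ᶠ t in 𝓝[>] (0 : ℝ), sparseInput off α t ∈ stdSimplex ℝ X ∧
      klSum (output W (sparseInput off α t)) (W off) ≤ t ^ 2 * (2 * δ / τ ^ 2) / 2 ∧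
      (∀ y, 0 < output W (sparseInput off α t) y) ∧
      (∀ x y, |Real.log (W x y / output W (sparseInput off α t) y)| ≤ K) ∧
      ∑ x, ∑ y, sparseInput off α t x * W x y *
        Real.log (W x y / output W (sparseInput off α t) y) ^ 2 ≤ B * t := by
    filter_upwards [eventually_sparseInput_mem hα, nhdsWithin_le_nhds
      (eventually_klSum_output_le hW hoff hs (hv ▸ hvδ)), hKB] with t h1 h2 h3
    exact ⟨h1, h2, h3⟩
  -- The term l δ pays for the divergence subtracted from the information; the factor 2 absorbs the
  -- ceiling in the code size.
  have hlim : Tendsto (fun n : ℕ => Real.exp (-(l * ((τ * v - ρ) / 2)) * √(n : ℝ) + l * δ)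
      + 2 * Real.exp (-(ρ - r) * √(n : ℝ))) atTop (𝓝 (0 + 2 * 0)) := by
    refine Tendsto.add ?_ (Tendsto.const_mul 2 ?_)
    · refine Real.tendsto_exp_atBot.comp (tendsto_atBot_add_const_right _ _ ?_)
      exact tendsto_sqrt_natCast_atTop.const_mul_atTop_of_neg (neg_lt_zero.2 (by positivity))
    · refine Real.tendsto_exp_atBot.comp ?_
      exact tendsto_sqrt_natCast_atTop.const_mul_atTop_of_neg (neg_lt_zero.2 (by rw [hρ]; linarith))
  rw [mul_zero, add_zero] at hlim
  filter_upwards [(tendsto_div_sqrt_natCast hτ).eventually hev, hlim.eventually (gt_mem_nhds hε),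
    eventually_gt_atTop 0] with n ht hn hn0
  obtain ⟨hP, hkl, hO, hKt, hBt⟩ := ht
  have hs0 : 0 < √(n : ℝ) := Real.sqrt_pos.2 (by exact_mod_cast hn0)
  have hsq : √(n : ℝ) ^ 2 = n := Real.sq_sqrt (by positivity)
  set s := √(n : ℝ) with hsdef
  set t := τ / s with htdef
  have hnt : n * t = τ * s := by rw [← hsq, htdef]; field_simp
  have hnkl : n * klSum (output W (sparseInput off α t)) (W off) ≤ δ := by
    refine (mul_le_mul_of_nonneg_left hkl (by positivity)).trans (le_of_eq ?_)
    rw [← hsq, htdef]; field_simp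
  refine achievable_of_iid (T := ρ * s) hW hoff hP hO (Nat.ceil_pos.2 (Real.exp_pos _)) hnkl hl.le
    (fun x y => ?_) (le_trans ?_ hn.le)
  · rw [abs_mul, abs_of_pos hl]
    exact (mul_le_mul_of_nonneg_left (hKt x y) hl.le).trans hlK
  · refine add_le_add (Real.exp_le_exp.2 ?_) ?_
    · rw [mutualInfo_sparseInput hW hoff hq hC hs hP, ← hv]
      have h1 : l ^ 2 * (n * ∑ x, ∑ y, sparseInput off α t x * W x y *
          Real.log (W x y / output W (sparseInput off α t) y) ^ 2) ≤ l ^ 2 * (B * (n * t)) := by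
        refine mul_le_mul_of_nonneg_left ?_ (sq_nonneg _)
        refine (mul_le_mul_of_nonneg_left hBt (by positivity)).trans (le_of_eq (by ring))
      have h2 : l ^ 2 * (B * (n * t)) ≤ l * ((τ * v - ρ) / 2) * s := by
        rw [hnt]
        calc l ^ 2 * (B * (τ * s)) = l * (l * (B * τ)) * s := by ring
          _ ≤ l * ((τ * v - ρ) / 2) * s := by gcongr
      have h3 := mul_le_mul_of_nonneg_left hnkl hl.le
      have h4 : n * (l * (t * v)) = l * (τ * v) * s := by
        calc n * (l * (t * v)) = l * v * (n * t) := by ring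
          _ = _ := by rw [hnt]; ring
      nlinarith
    · have hM : (⌈Real.exp (r * s)⌉₊ : ℝ) ≤ 2 * Real.exp (r * s) := by
        have h1 := (Nat.ceil_lt_add_one (Real.exp_pos (r * s)).le).le
        have h2 : 1 ≤ Real.exp (r * s) := Real.one_le_exp (by positivity)
        linarith
      rw [div_le_iff₀ (Real.exp_pos _), mul_assoc, ← Real.exp_add]
      refine hM.trans (le_of_eq ?_)
      congr 2
      ring

lemma achievable_one [DecidableEq X] (hoff : ∀ y, 0 < W off y) {δ ε : ℝ} (hδ : 0 ≤ δ)
    (hε : 0 ≤ ε) (n : ℕ) : Achievable W off δ ε n 1 := by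
  have hc : ∀ c : Code X Y n 1, ∀ m y, c.2 y = m := fun c m y => Subsingleton.elim _ _
  set c₀ : Code X Y n 1 := (fun _ _ => off, fun _ => 0) with hc₀
  refine ⟨one_pos, Pi.single c₀ 1, single_mem_stdSimplex ℝ c₀, ?_, ?_⟩
  · rw [relEntropy_eq_klSum (blockLaw_pos fun _ => hoff)]
    have : codeOutput W (Pi.single c₀ 1) = blockLaw W (fun _ : Fin n => off) := by
      funext y
      simp [codeOutput, Pi.single_apply, hc₀]
    rw [this]
    rw [klSum_self]
    exact_mod_cast hδ
  · unfold codeError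
    simpa only [if_pos (hc _ _ _), Finset.sum_const_zero, mul_zero] using hε

end Achievability

/-! ### The scaling constant -/

section Limit

variable {X Y : Type*} [Fintype X] [Fintype Y] [DecidableEq Y] {W : X → Y → ℝ}
  {off : X} {q : Y → ℝ} {C : ℝ} {α : X → ℝ}

/-- Asymptotic converse. -/
lemma eventually_maxLogSize_le (hW : IsChannel W) (hoff : ∀ y, 0 < W off y) (hq : ∀ y, 0 < q y)
    (hC : ∀ x, klSum (W x) q = C)
    (h0 : ∑ y, W off y * (Real.log (q y / W off y) + C) = 0) {v δ ε c : ℝ}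
    (hv : v = ∑ y, W off y * (Real.log (q y / W off y) + C) ^ 2) (hδ : 0 < δ) (hε : ε < 1)
    (hc : √(2 * v) / (1 - ε) < c) :
    ∀ᶠ n : ℕ in atTop, maxLogSize W off δ ε n ≤ ((c * √(n * δ) : ℝ) : EReal) := by
  have hε' : 0 < 1 - ε := by linarith
  rw [div_lt_iff₀ hε'] at hc
  obtain ⟨w, hw1, hw2⟩ := exists_between hc
  have hw0 : 0 < w := (Real.sqrt_nonneg _).trans_lt hw1
  have hvw : v < w ^ 2 / 2 := by
    have := (Real.sqrt_lt' hw0).1 hw1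
    linarith
  have hsδ : 0 < √δ := Real.sqrt_pos.2 hδ
  have hδsq : √δ ^ 2 = δ := Real.sq_sqrt hδ.le
  have hexp := eventually_sum_le_sq (fun y => (hoff y).le) h0
    (fun η hη => eventually_exp_sub_one_le hη) (hv ▸ hvw)
  -- The slope l = 2√δ/(w√n) minimizes (δ + n l² w²/4)/l, with minimum w√(nδ).
  have hκ : 0 < 2 * √δ / w := by positivity
  have hlim : Tendsto (fun n : ℕ => (c * (1 - ε) - w) * √δ * √(n : ℝ)) atTop atTop :=
    tendsto_sqrt_natCast_atTop.const_mul_atTop (mul_pos (by linarith) hsδ)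
  filter_upwards [((tendsto_div_sqrt_natCast hκ).mono_right nhdsWithin_le_nhds).eventually hexp,
    hlim.eventually_ge_atTop (Real.log 2), eventually_gt_atTop 0] with n hn hlog hn0
  have hs0 : 0 < √(n : ℝ) := Real.sqrt_pos.2 (by exact_mod_cast hn0)
  have hsq : √(n : ℝ) ^ 2 = n := Real.sq_sqrt (by positivity)
  have hsqrt : √(n * δ) = √(n : ℝ) * √δ := Real.sqrt_mul (by positivity) δ
  set s := √(n : ℝ)
  set d := √δ
  refine iSup₂_le fun M ⟨hM, p, hp, hcov, herr⟩ => ?_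
  rw [relEntropy_eq_klSum (blockLaw_pos fun _ => hoff)] at hcov
  have hmain := log_card_le_of_covert (l := 2 * d / w / s)
    (w := (2 * d / w / s) ^ 2 * (w ^ 2 / 2) / 2) hW hoff hq hC hM hp herr
    (by exact_mod_cast hcov) (by positivity) (by
      refine le_trans ?_ (Real.add_one_le_exp _)
      simp only [mul_sub, mul_one, Finset.sum_sub_distrib, (hW off).2] at hn
      linarith)
  have hcalc : (δ + n * ((2 * d / w / s) ^ 2 * (w ^ 2 / 2) / 2)) / (2 * d / w / s) = w * d * s := by
    rw [← hsq, ← hδsq]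
    field_simp
    ring
  rw [hcalc] at hmain
  have : Real.log M ≤ c * √(n * δ) := by
    rw [hsqrt]
    refine le_of_mul_le_mul_left ?_ hε'
    nlinarith
  exact_mod_cast this

/-- Asks only for a positive q at equal divergence from all rows, so it applies to the uniform-error
channel without computing its capacity. -/
lemma isScalingConstant_of_klSum_eq [DecidableEq X] (hW : IsChannel W) (hoff : ∀ y, 0 < W off y)
    (hq : ∀ y, 0 < q y) (hC : ∀ x, klSum (W x) q = C) (hα : ∀ x, x ≠ off → 0 ≤ α x)
    (hs : ∀ y, ∑ x ∈ Finset.univ.erase off, α x * (W x y - W off y) =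
      W off y * (Real.log (q y / W off y) + C)) {v δ : ℝ}
    (hv : v = ∑ y, W off y * (Real.log (q y / W off y) + C) ^ 2) (hδ : 0 < δ) :
    IsScalingConstant W off δ ((√(2 * v) : ℝ) : EReal) := by
  have hv0 : 0 ≤ v := by
    rw [hv]; exact Finset.sum_nonneg fun y _ => mul_nonneg (hoff y).le (sq_nonneg _)
  have hspos : ∀ n : ℕ, 0 < n → 0 < √(n * δ) := fun n hn =>
    Real.sqrt_pos.2 (mul_pos (by exact_mod_cast hn) hδ)
  have hupper : Tendsto (fun ε : ℝ => ((√(2 * v) / (1 - ε) : ℝ) : EReal)) (𝓝[>] 0)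
      (𝓝 ((√(2 * v) : ℝ) : EReal)) := by
    refine (continuous_coe_real_ereal.tendsto _).comp ?_
    have h1 : Tendsto (fun ε : ℝ => √(2 * v) / (1 - ε)) (𝓝 0) (𝓝 (√(2 * v) / (1 - 0))) :=
      tendsto_const_nhds.div (tendsto_const_nhds.sub tendsto_id) (by norm_num)
    simpa using h1.mono_left nhdsWithin_le_nhds
  refine tendsto_of_tendsto_of_tendsto_of_le_of_le' tendsto_const_nhds hupper ?_ ?_
  · filter_upwards [self_mem_nhdsWithin] with ε hε
    have hε0 : (0 : ℝ) < ε := hε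
    refine EReal.ge_of_forall_gt_iff_ge.1 fun a ha => ?_
    have ha' : a < √(2 * v) := by exact_mod_cast ha
    refine le_liminf_of_le (by isBoundedDefault) ?_
    have hach : ∀ᶠ n : ℕ in atTop, ∃ M : ℕ, Achievable W off δ ε n M ∧ a * √(n * δ) ≤ Real.log M := by
      -- For negative a one message suffices. This also covers v = 0, where no nonnegative a lies
      -- below √(2v).
      rcases lt_or_ge a 0 with hneg | hnn
      · filter_upwards with n
        refine ⟨1, achievable_one hoff hδ.le hε0.le n, ?_⟩
        simp only [Nat.cast_one, Real.log_one]
        exact mul_nonpos_of_nonpos_of_nonneg hneg.le (Real.sqrt_nonneg _)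
      · obtain ⟨b, hab, hb⟩ := exists_between ha'
        have hb0 : 0 < b := hnn.trans_lt hab
        have hb2 := (Real.lt_sqrt hb0.le).1 hb
        have hvpos : 0 < v := by nlinarith
        have hsδ : 0 < √δ := Real.sqrt_pos.2 hδ
        have hδsq : √δ ^ 2 = δ := Real.sq_sqrt hδ.le
        -- With a < b < √(2v), this τ gives τv = b√δ > r and τ²v = b²δ/v < 2δ.
        filter_upwards [eventually_achievable (τ := b * √δ / v) (δ := δ) (r := a * √δ) hW hoff hq
          hC hα hs hv (by positivity) (by
            rw [div_pow, mul_pow, hδsq]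
            have : b ^ 2 * δ / v ^ 2 * v = b ^ 2 / v * δ := by field_simp
            rw [this]
            exact mul_lt_mul_of_pos_right ((div_lt_iff₀ hvpos).2 hb2) hδ) (by positivity) (by
            rw [div_mul_cancel₀ _ hvpos.ne']
            exact mul_lt_mul_of_pos_right hab hsδ) hε0] with n hn
        refine ⟨_, hn, ?_⟩
        rw [Real.sqrt_mul (by positivity) δ, Real.le_log_iff_exp_le (by
          exact_mod_cast Nat.ceil_pos.2 (Real.exp_pos _))]
        refine le_trans (le_of_eq ?_) (Nat.le_ceil _)
        congr 1
        ring
    filter_upwards [hach, eventually_gt_atTop 0] with n ⟨M, hM, hlog⟩ hn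
    rw [EReal.le_div_iff_mul_le (by exact_mod_cast hspos n hn) (EReal.coe_ne_top _)]
    refine le_trans ?_ (le_iSup₂ (f := fun (M : ℕ) (_ : Achievable W off δ ε n M) =>
      ((Real.log M : ℝ) : EReal)) M hM)
    exact_mod_cast hlog
  · filter_upwards [nhdsWithin_le_nhds (gt_mem_nhds one_pos)] with ε hε
    refine EReal.le_of_forall_lt_iff_le.1 fun c hc => ?_
    have hc' : √(2 * v) / (1 - ε) < c := by exact_mod_cast hc
    refine liminf_le_of_le (by isBoundedDefault) fun b hb => ?_
    obtain ⟨n, hbn, hn, hn0⟩ := (hb.and ((eventually_maxLogSize_le hW hoff hq hC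
      (sum_tangent_eq_zero hW hs) hv hδ hε hc').and (eventually_gt_atTop 0))).exists
    refine hbn.trans ?_
    rw [EReal.div_le_iff_le_mul (by exact_mod_cast hspos n hn0) (EReal.coe_ne_top _), mul_comm]
    exact_mod_cast hn

end Limit

/-! ### Kuhn–Tucker conditions at capacity -/

/-- From log u ≤ u − 1. It makes the divergence quadratic in a perturbation of the output. -/
lemma klSum_le_chiSq {A : Type*} [Fintype A] {P q : A → ℝ} (hP : P ∈ stdSimplex ℝ A)
    (hq : q ∈ stdSimplex ℝ A) (hpos : ∀ a, 0 < q a) :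
    klSum P q ≤ ∑ a, (P a - q a) ^ 2 / q a := by
  have h1 : ∀ a, P a * Real.log (P a / q a) ≤ (P a - q a) ^ 2 / q a + (P a - q a) := by
    intro a
    have hqa := hpos a
    have h2 : P a * (P a / q a - 1) = (P a - q a) ^ 2 / q a + (P a - q a) := by field_simp; ring
    rw [← h2]
    rcases (hP.1 a).eq_or_lt with h0 | h0
    · rw [← h0]; simp
    · exact mul_le_mul_of_nonneg_left (Real.log_le_sub_one_of_pos (div_pos h0 hqa)) h0.le
  refine (Finset.sum_le_sum fun a _ => h1 a).trans (le_of_eq ?_)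
  rw [Finset.sum_add_distrib, Finset.sum_sub_distrib, hP.2, hq.2]
  ring

lemma eq_of_klSum_eq_zero {A : Type*} [Fintype A] {P q : A → ℝ} (hP : P ∈ stdSimplex ℝ A)
    (hq : q ∈ stdSimplex ℝ A) (hpos : ∀ a, 0 < q a) (h : klSum P q = 0) : P = q := by
  have h1 : ∑ a, q a * InformationTheory.klFun (P a / q a) = 0 := by
    have : ∀ a, q a * InformationTheory.klFun (P a / q a)
        = P a * Real.log (P a / q a) + (q a - P a) := by
      intro a
      have hqa := hpos a
      unfold InformationTheory.klFun
      field_simp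
      ring
    rw [Finset.sum_congr rfl fun a _ => this a, Finset.sum_add_distrib, Finset.sum_sub_distrib,
      hP.2, hq.2, sub_self, add_zero]
    exact h
  have hnn : ∀ a, 0 ≤ P a / q a := fun a => div_nonneg (hP.1 a) (hpos a).le
  rw [Finset.sum_eq_zero_iff_of_nonneg fun a _ =>
    mul_nonneg (hpos a).le (InformationTheory.klFun_nonneg (hnn a))] at h1
  funext a
  have h2 := (mul_eq_zero.1 (h1 a (Finset.mem_univ a))).resolve_left (hpos a).ne'
  rw [InformationTheory.klFun_eq_zero_iff (hnn a), div_eq_one_iff_eq (hpos a).ne'] at h2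
  exact h2

section Capacity

variable {X Y : Type*} [Fintype X] [Fintype Y] {W : X → Y → ℝ} {P : X → ℝ}

lemma IsCapacityAchieving.capacity_eq (h : IsCapacityAchieving W P) :
    capacity W = mutualInfo W P := by
  refine IsGreatest.csSup_eq ⟨⟨P, h.1, rfl⟩, ?_⟩
  rintro _ ⟨P', hP', rfl⟩
  exact h.2 P' hP'

/-- Kuhn–Tucker inequality for a capacity-achieving input distribution. -/
lemma IsCapacityAchieving.klSum_le (hW : IsChannel W) (h : IsCapacityAchieving W P)
    (hO : ∀ y, 0 < output W P y) (x : X) : klSum (W x) (output W P) ≤ mutualInfo W P := by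
  classical
  have hOs := output_mem_stdSimplex hW h.1
  set S := ∑ y, (W x y - output W P y) ^ 2 / output W P y with hS
  have hS0 : 0 ≤ S := Finset.sum_nonneg fun y _ => div_nonneg (sq_nonneg _) (hO y).le
  have hI : mutualInfo W P = ∑ x, P x * klSum (W x) (output W P) := by
    rw [mutualInfo_eq_sub hW h.1 hO, klSum_self, sub_zero]
  -- Mixing mass t onto x changes the information by t times the left side, minus a divergence at
  -- most t² S; optimality of P forbids an increase.
  have key : ∀ t : ℝ, 0 < t → t ≤ 1 →
      klSum (W x) (output W P) - mutualInfo W P ≤ t * S := by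
    intro t ht0 ht1
    set P' : X → ℝ := (1 - t) • P + t • Pi.single x 1 with hP'
    have hP's : P' ∈ stdSimplex ℝ X :=
      convex_stdSimplex ℝ X h.1 (single_mem_stdSimplex ℝ x) (by linarith) ht0.le (by ring)
    have hsum : ∀ f : X → ℝ, ∑ z, P' z * f z = (1 - t) * ∑ z, P z * f z + t * f x := by
      intro f
      simp only [hP', Pi.add_apply, Pi.smul_apply, smul_eq_mul, add_mul, Finset.sum_add_distrib,
        mul_assoc, ← Finset.mul_sum]
      simp [Pi.single_apply]
    have hout : ∀ y, output W P' y = output W P y + t * (W x y - output W P y) := by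
      intro y
      rw [output, hsum (fun z => W z y)]
      change (1 - t) * output W P y + _ = _
      ring
    have h1 := h.2 P' hP's
    rw [mutualInfo_eq_sub hW hP's hO, hsum, ← hI] at h1
    have h2 : klSum (output W P') (output W P) ≤ t ^ 2 * S := by
      refine (klSum_le_chiSq (output_mem_stdSimplex hW hP's) hOs hO).trans (le_of_eq ?_)
      rw [hS, Finset.mul_sum]
      refine Finset.sum_congr rfl fun y _ => ?_
      rw [hout]
      ring
    refine le_of_mul_le_mul_left ?_ ht0
    nlinarith
  by_contra! hlt
  have hd : 0 < klSum (W x) (output W P) - mutualInfo W P := by linarith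
  set D := klSum (W x) (output W P) - mutualInfo W P
  have h1 := key (min 1 (D / (S + 1) / 2)) (lt_min one_pos (by positivity)) (min_le_left _ _)
  have h2 : min 1 (D / (S + 1) / 2) * S ≤ D / (S + 1) / 2 * S :=
    mul_le_mul_of_nonneg_right (min_le_right _ _) hS0
  have h3 : D / (S + 1) / 2 * S ≤ D / 2 := by
    rw [div_div, div_mul_eq_mul_div, div_le_div_iff₀ (by positivity) two_pos]
    nlinarith
  linarith

/-- The nonnegative Kuhn–Tucker slacks have P-mean zero, and every weight is positive. -/
lemma IsCapacityAchieving.klSum_eq (hW : IsChannel W) (h : IsCapacityAchieving W P)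
    (hpos : ∀ x, 0 < P x) (hO : ∀ y, 0 < output W P y) (x : X) :
    klSum (W x) (output W P) = mutualInfo W P := by
  have hI : mutualInfo W P = ∑ x, P x * klSum (W x) (output W P) := by
    rw [mutualInfo_eq_sub hW h.1 hO, klSum_self, sub_zero]
  have h0 : ∑ x, P x * (mutualInfo W P - klSum (W x) (output W P)) = 0 := by
    simp only [mul_sub, Finset.sum_sub_distrib, ← Finset.sum_mul, h.1.2, ← hI]
    ring
  rw [Finset.sum_eq_zero_iff_of_nonneg fun x _ =>
    mul_nonneg (hpos x).le (sub_nonneg.2 (h.klSum_le hW hO x))] at h0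
  have := (mul_eq_zero.1 (h0 x (Finset.mem_univ x))).resolve_left (hpos x).ne'
  linarith

/-- If all symbols are used, all input letters are at divergence `capacity W` from the (unique)
capacity-achieving output distribution. -/
lemma klSum_eq_capacity (hW : IsChannel W) {off : X} (hoff : ∀ y, 0 < W off y)
    (hall : AllSymbolsUsed W) {q : Y → ℝ} (hq : IsCapacityAchievingOutput W q) :
    (∀ y, 0 < q y) ∧ ∀ x, klSum (W x) q = capacity W := by
  obtain ⟨P, hP, hpos⟩ := hall
  obtain ⟨P', hP', rfl⟩ := hq
  have hO : ∀ y, 0 < output W P y := fun y =>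
    (mul_pos (hpos off) (hoff y)).trans_le <|
      Finset.single_le_sum (f := fun x => P x * W x y)
        (fun x _ => mul_nonneg (hpos x).le ((hW x).1 y)) (Finset.mem_univ off)
  have hC := hP.klSum_eq hW hpos hO
  -- Any other optimal input has information C minus its output's divergence from this one, so that
  -- divergence vanishes.
  have h1 := mutualInfo_eq_sub hW hP'.1 hO
  simp only [hC, ← Finset.sum_mul, hP'.1.2, one_mul] at h1
  rw [← hP'.capacity_eq, ← hP.capacity_eq] at h1
  have h2 : output W P' = output W P := eq_of_klSum_eq_zero (output_mem_stdSimplex hW hP'.1)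
    (output_mem_stdSimplex hW hP.1) hO (by linarith)
  rw [h2, hP.capacity_eq]
  exact ⟨hO, hC⟩

lemma variance_log_div_eq {Q q : Y → ℝ} (hQ : Q ∈ stdSimplex ℝ Y) {C : ℝ}
    (h0 : ∑ y, Q y * (Real.log (q y / Q y) + C) = 0) :
    variance Q (fun y => Real.log (Q y / q y))
      = ∑ y, Q y * (Real.log (q y / Q y) + C) ^ 2 := by
  have hlog : ∀ y, Real.log (Q y / q y) = -Real.log (q y / Q y) := fun y => by
    rw [← Real.log_inv, inv_div]
  have hmean : ∑ y, Q y * Real.log (Q y / q y) = C := by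
    simp only [mul_add, Finset.sum_add_distrib, ← Finset.sum_mul, hQ.2] at h0
    simp only [hlog, mul_neg, Finset.sum_neg_distrib]
    linarith
  unfold variance
  rw [hmean]
  refine Finset.sum_congr rfl fun y _ => ?_
  dsimp only
  rw [hlog]
  ring

end Capacity

/-! ### The uniform-error channel -/

section UniformError

lemma sum_ite_eq_fin {k : ℕ} (x : Fin k) (a b : ℝ) :
    ∑ y : Fin k, (if y = x then a else b) = a + ((k : ℝ) - 1) * b := by
  have : ∀ y : Fin k, (if y = x then a else b) = (if y = x then a - b else 0) + b := fun y => by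
    split_ifs <;> ring
  simp only [this, Finset.sum_add_distrib, Finset.sum_ite_eq', Finset.mem_univ, if_true,
    Finset.sum_const, Finset.card_univ, Fintype.card_fin, nsmul_eq_mul]
  ring

lemma isScalingConstant_uniformErrorChannel {k : ℕ} (hk : 2 ≤ k) {p δ : ℝ} (hp0 : 0 < p)
    (hp1 : p < 1) (hδ : 0 < δ) (off : Fin k) :
    IsScalingConstant (uniformErrorChannel k p) off δ ((√(2 * uniformErrorVar k p) : ℝ) : EReal) := by
  have hk1 : (0 : ℝ) < (k : ℝ) - 1 := by
    have : (2 : ℝ) ≤ k := by exact_mod_cast hk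
    linarith
  have hk0 : (0 : ℝ) < k := by linarith
  set W := uniformErrorChannel k p with hWdef
  set e := p / ((k : ℝ) - 1) with he
  have he0 : 0 < e := div_pos hp0 hk1
  have hke : ((k : ℝ) - 1) * e = p := by rw [he]; field_simp
  have hWe : ∀ x y, W x y = if y = x then 1 - p else e := fun x y => rfl
  have hpos : ∀ x y, 0 < W x y := fun x y => by rw [hWe]; split_ifs <;> linarith
  have hW : IsChannel W := fun x => ⟨fun y => (hpos x y).le, by
    simp only [hWe]; rw [sum_ite_eq_fin, hke]; ring⟩
  set a := Real.log (1 - p) with ha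
  set b := Real.log e with hb
  have hlogk : Real.log (1 / (k : ℝ)) = -Real.log k := by rw [one_div, Real.log_inv]
  have hlogW : ∀ x y, Real.log (W x y) = if y = x then a else b := fun x y => by
    rw [hWe]; split_ifs <;> rfl
  set C := Real.log k + (1 - p) * a + p * b with hCdef
  have hC : ∀ x, klSum (W x) (fun _ => 1 / (k : ℝ)) = C := by
    intro x
    have : ∀ y, W x y * Real.log (W x y / (1 / (k : ℝ))) =
        if y = x then (1 - p) * (a + Real.log k) else e * (b + Real.log k) := by
      intro y
      rw [Real.log_div (hpos x y).ne' (by positivity), hlogk, hlogW, hWe]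
      split_ifs <;> ring
    unfold klSum
    simp only [this]
    rw [sum_ite_eq_fin, ← mul_assoc, hke, hCdef]
    ring
  have htan : ∀ y, Real.log (1 / (k : ℝ) / W off y) + C =
      if y = off then p * (b - a) else (1 - p) * (a - b) := by
    intro y
    rw [Real.log_div (by positivity) (hpos off y).ne', hlogk, hlogW, hCdef]
    split_ifs <;> ring
  -- By symmetry one constant weight c serves all symbols. It is nonnegative because log is
  -- monotone, so a − b and 1 − p − e have the same sign; if 1 − p = e both vanish and c = 0 works.
  obtain ⟨c, hc0, hc⟩ : ∃ c : ℝ, 0 ≤ c ∧ c * (1 - p - e) = e * ((1 - p) * (a - b)) := by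
    rcases eq_or_ne (1 - p - e) 0 with h | h
    · refine ⟨0, le_rfl, ?_⟩
      have : a = b := by rw [ha, hb, show 1 - p = e by linarith]
      rw [this]; ring
    · refine ⟨e * ((1 - p) * (a - b)) / (1 - p - e), ?_, div_mul_cancel₀ _ h⟩
      rcases le_total e (1 - p) with h' | h'
      · have : b ≤ a := Real.log_le_log he0 h'
        exact div_nonneg (mul_nonneg he0.le (mul_nonneg (by linarith) (by linarith))) (by linarith)
      · have : a ≤ b := Real.log_le_log (by linarith) h'
        exact div_nonneg_of_nonpos (mul_nonpos_of_nonneg_of_nonpos he0.le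
          (mul_nonpos_of_nonneg_of_nonpos (by linarith) (by linarith))) (by linarith)
  refine isScalingConstant_of_klSum_eq (q := fun _ => 1 / (k : ℝ)) (C := C) (α := fun _ => c)
    hW (hpos off) (fun _ => by positivity) hC (fun _ _ => hc0) (fun y => ?_) ?_ hδ
  -- The `off` term is zero and the columns also sum to 1, so the system reduces to c(1 − k
  -- W(y|off)) = s(y).
  · rw [htan, Finset.sum_erase _ (by simp), ← Finset.mul_sum, Finset.sum_sub_distrib]
    have h1 : ∑ x, W x y = 1 := by
      simp only [hWe, eq_comm (a := y)]
      rw [sum_ite_eq_fin, hke]; ring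
    rw [h1, Finset.sum_const, Finset.card_univ, Fintype.card_fin, nsmul_eq_mul, hWe]
    split_ifs
    · linear_combination (-((k : ℝ) - 1)) * hc + (-c + (1 - p) * (b - a)) * hke
    · linear_combination hc - c * hke
  · have : ∀ y, W off y * (Real.log (1 / (k : ℝ) / W off y) + C) ^ 2 =
        if y = off then (1 - p) * (p * (b - a)) ^ 2 else e * ((1 - p) * (a - b)) ^ 2 := by
      intro y
      rw [htan, hWe]
      split_ifs <;> rfl
    simp only [this]
    rw [sum_ite_eq_fin, ← mul_assoc, hke, uniformErrorVar, one_div, Real.log_inv,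
      show ((k : ℝ) - 1) / p = e⁻¹ by rw [he, inv_div], Real.log_inv]
    ring

end UniformError

end

end Covert

theorem theorem4 :
    (∀ {X Y : Type*} [Fintype X] [DecidableEq X] [Fintype Y] [DecidableEq Y]
      (W : X → Y → ℝ) (off : X) (Qstar : Y → ℝ) (δ : ℝ),
      Covert.IsChannel W →
      Function.Injective W →
      (∀ y, 0 < W off y) →
      0 < δ →
      Covert.AllSymbolsUsed W →
      Covert.IsCapacityAchievingOutput W Qstar →
      (∃ α : X → ℝ, (∀ x, x ≠ off → 0 ≤ α x) ∧
        ∀ y, ∑ x ∈ Finset.univ.erase off, α x * (W x y - W off y) =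
          Covert.tangentVector W off Qstar y) →
      Covert.IsScalingConstant W off δ
        ((Real.sqrt (2 * Covert.variance (W off)
          (fun y => Real.log (W off y / Qstar y))) : ℝ) : EReal)) ∧
    (∀ (k : ℕ) (hk : 2 ≤ k) (p : ℝ) (δ : ℝ), 0 < p → p < 1 → 0 < δ →
      Covert.IsScalingConstant (Covert.uniformErrorChannel k p) (⟨0, by omega⟩ : Fin k) δ
        ((Real.sqrt (2 * Covert.uniformErrorVar k p) : ℝ) : EReal)) := by
  refine ⟨?_, fun k hk p δ hp0 hp1 hδ =>
    Covert.isScalingConstant_uniformErrorChannel hk hp0 hp1 hδ _⟩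
  intro X Y _ _ _ _ W off Qstar δ hW _ hoff hδ hall hQ ⟨α, hα, hs⟩
  obtain ⟨hq, hC⟩ := Covert.klSum_eq_capacity hW hoff hall hQ
  exact Covert.isScalingConstant_of_klSum_eq hW hoff hq hC hα hs
    (Covert.variance_log_div_eq (hW off) (Covert.sum_tangent_eq_zero hW hs)) hδ
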